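/- For $n\ge 1$ let $G_1=G_1^{(n,n)}=\{(i,j): 1\le i,j\le n\}$ be the $n\times n$ square grid. Let $G_{1,T,R}$ be the multigraph with vertex set $G_1\cup\{T,R\}$ ($T$ the terminal, $R$ the root) obtained as follows: keep all edges of the square lattice $\mathbb Z^2$ having at least one end in $G_1$; among the lattice edges leaving $G_1$ at $(1,1)$ let exactly one, the one to $(0,1)$, lead to $T$, let every other lattice edge leaving $G_1$ lead to $R$ (possibly creating parallel edges), and add one edge $TR$. Thus every vertex of $G_1$ has degree exactly $4$. All edges have weight $1$. Let $\triangle f(v)=\sum_w c_{vw}(f(v)-f(w))$ be its Laplacian, $c_{vw}$ being the number of edges joining $v$ and $w$, and let $K$ be the restriction $1_{G_1}\triangle 1_{G_1}$ to $G_1$ (so $K=4I-\mathrm{Adj}(G_1)$). Then $K$ is invertible; put $A^{(n,n)}=K^{-1}$. (1) For all fixed integers $x,y\ge 1$, the integral below converges absolutely and $$\lim_{n\to\infty}A^{(n,n)}((x,y),(1,1))=\frac{2}{\pi^2}\iint_{(0,\pi)^2}\frac{\sin(\theta x)\sin(\phi y)\sin\theta\sin\phi}{2-\cos\theta-\cos\phi}\,d\theta\,d\phi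 .$$ (2) Choose uniformly at random a spanning tree of $G_{1,T,R}$ containing the edge $TR$ (equivalently, a spanning tree of the multigraph obtained by identifying $T$ with $R$). Let $l_T$ be the length of its TI-tree, the part of the tree attached to the root through the edge $TR$: that is, the number of vertices of $G_1$ connected to $T$ in the tree after the edge $TR$ is cut (equivalently, the number of edges of the TI-tree other than $TR$). Then for every $n\ge 1$ $$\mathbf E[l_T]=\sum_{(x,y)\in G_1}A^{(n,n)}((x,y),(1,1)),$$ and $\mathbf E[l_T]=\frac{2}{\pi}\log n\,(1+o(1))$ as $n\to\infty$. -/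

import Mathlib

open Real Set Filter Topology MeasureTheory
open scoped BigOperators Asymptotics

/-! ### Laplacian and trees for multigraphs -/

/-- The number of edges joining `v` and `w`: the weight `c_{vw}` when every edge has weight `1`. -/
noncomputable def edgeMultiplicity {α β : Type*} (G : Graph α β) (v w : α) : ℕ :=
  {e : β | G.IsLink e v w}.ncard

/-- The graph Laplacian `(Δ_G f)(v) = ∑_{w ∈ V(G)} c_{vw} (f v - f w)`, all edges having
weight `1` (parallel edges add up). -/
noncomputable def graphLaplacian {α β : Type*} (G : Graph α β) (f : α → ℝ) (v : α) : ℝ :=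
  ∑ᶠ w ∈ G.vertexSet, (edgeMultiplicity G v w : ℝ) * (f v - f w)

/-- There is a path from `u` to `v` in `G`. -/
def Graph.Reaches {α β : Type*} (G : Graph α β) (u v : α) : Prop :=
  Relation.ReflTransGen G.Adj u v

/-- A (multi)graph is a tree if it is nonempty, connected, and acyclic; acyclicity is expressed by
saying that every edge is a bridge (so there are neither loops nor pairs of parallel edges). -/
structure Graph.IsTree {α β : Type*} (G : Graph α β) : Prop where
  nonempty : G.vertexSet.Nonempty
  connected : ∀ u ∈ G.vertexSet, ∀ v ∈ G.vertexSet, G.Reaches u v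
  acyclic : ∀ e u v, G.IsLink e u v → ¬ (G.deleteEdges {e}).Reaches u v

/-- `F` is the edge set of a spanning tree of `G`. -/
def Graph.IsSpanningTree {α β : Type*} (G : Graph α β) (F : Set β) : Prop :=
  F ⊆ G.edgeSet ∧ (G.restrict F).IsTree

/-! ### The rectangle with one terminal -/

/-- The vertices `{(i, j) | 1 ≤ i ≤ n, 1 ≤ j ≤ m}` of `G₁`. -/
noncomputable def gridVertices (n m : ℕ) : Finset (ℤ × ℤ) :=
  Finset.Icc 1 (n : ℤ) ×ˢ Finset.Icc 1 (m : ℤ)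

/-- Nearest neighbours in the square lattice. -/
def LatticeAdj (p q : ℤ × ℤ) : Prop :=
  |p.1 - q.1| + |p.2 - q.2| = 1

/-- Vertices of `G_{1,T,R}`: lattice sites, the terminal `T` and the root `R`. -/
inductive GridVertex : Type
  | site (p : ℤ × ℤ)
  | terminal
  | root

open Classical in
/-- A site of the rectangle is itself; the outer lattice neighbour `(0,1)` of the corner `(1,1)`
is the terminal `T`; all other outer lattice sites are identified with the root `R`. -/
noncomputable def gridEndpoint (n m : ℕ) (p : ℤ × ℤ) : GridVertex :=
  if p ∈ gridVertices n m then .site p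
  else if p = (0, 1) then .terminal
  else .root

/-- The ends of an edge of `G_{1,T,R}`: the edge `none` joins `T` and `R`; the edges `some e` are
the lattice edges `e` with at least one end in the rectangle, their outer ends
being identified with `T` or `R` by `gridEndpoint`. -/
def GridLink (n m : ℕ) (e : Option (Sym2 (ℤ × ℤ))) (v w : GridVertex) : Prop :=
  (e = none ∧ ((v = .terminal ∧ w = .root) ∨ (v = .root ∧ w = .terminal))) ∨
  ∃ p q : ℤ × ℤ, e = some s(p, q) ∧ LatticeAdj p q ∧
    (p ∈ gridVertices n m ∨ q ∈ gridVertices n m) ∧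
    v = gridEndpoint n m p ∧ w = gridEndpoint n m q

/-- The multigraph `G_{1,T,R}` of the `n × m` rectangle with the terminal attached to `(1,1)`.
Every vertex of the rectangle has degree exactly `4`: the lattice edges leaving the rectangle are
kept, one of those at `(1,1)` leading to `T` and all the others to `R`
(so that several of them can be parallel). -/
def gridTR (n m : ℕ) : Graph GridVertex (Option (Sym2 (ℤ × ℤ))) where
  vertexSet := {v | (∃ p ∈ gridVertices n m, v = .site p) ∨ v = .terminal ∨ v = .root}
  IsLink := GridLink n m
  isLink_symm := by
    intro e _
    refine ⟨fun v w h => ?_⟩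
    rcases h with ⟨he, h⟩ | ⟨p, q, he, hpq, hg, hv, hw⟩
    · exact Or.inl ⟨he, by tauto⟩
    · refine Or.inr ⟨q, p, by rw [he, Sym2.eq_swap], ?_, hg.symm, hw, hv⟩
      unfold LatticeAdj at *
      rw [abs_sub_comm q.1, abs_sub_comm q.2, hpq]
  eq_or_eq_of_isLink_of_isLink := by
    rintro e x y v w (⟨he, h⟩ | ⟨p, q, he, -, -, hx, hy⟩) (⟨he', h'⟩ | ⟨p', q', he', -, -, hv, hw⟩)
    · grind
    · simp [he] at he'
    · simp [he] at he'
    · rw [he] at he'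
      rcases Sym2.eq_iff.1 (Option.some.inj he') with ⟨h, -⟩ | ⟨h, -⟩
      · left; rw [hx, hv, h]
      · right; rw [hx, hw, h]
  left_mem_of_isLink := by
    rintro e x y (⟨-, h⟩ | ⟨p, q, -, -, -, hx, -⟩)
    · grind
    · subst hx
      unfold gridEndpoint
      split_ifs with h1 h2
      · exact Or.inl ⟨p, h1, rfl⟩
      · exact Or.inr (Or.inl rfl)
      · exact Or.inr (Or.inr rfl)

/-- `K`, the Laplacian restricted to `G₁` (that is, `1_{G₁} Δ 1_{G₁}`), as a matrix:
`K(p, q) = (Δ δ_q)(p)`. -/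
noncomputable def gridK (n m : ℕ) :
    Matrix (gridVertices n m) (gridVertices n m) ℝ :=
  Matrix.of fun p q =>
    graphLaplacian (gridTR n m) (Set.indicator {GridVertex.site q} 1) (GridVertex.site p)

open Classical in
/-- The matrix elements `A^{(n,m)}(p, q)` of `A^{(n,m)} = K⁻¹` for sites `p, q` of the rectangle
(and `0`, by convention, if `p` or `q` is not in the rectangle). -/
noncomputable def gridA (n m : ℕ) (p q : ℤ × ℤ) : ℝ :=
  if h : p ∈ gridVertices n m ∧ q ∈ gridVertices n m then
    (gridK n m)⁻¹ ⟨p, h.1⟩ ⟨q, h.2⟩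
  else 0

/-- The spanning trees of `G_{1,T,R}` occurring in the generalized Temperley bijection for one
impurity: those containing the edge `TR`, i.e. consisting of one TI-tree (the part hanging from the
root by the edge `TR`) and IO-trees (the parts hanging from the root by other edges), without
TO-tree. They are in bijection with the spanning trees of the graph `G_{1,R}` in which `T` is
identified with `R`. -/
def tiSpanningTrees (n m : ℕ) : Set (Set (Option (Sym2 (ℤ × ℤ)))) :=
  {F | (gridTR n m).IsSpanningTree F ∧ none ∈ F}

/-- The length `l_T` of the TI-tree of the spanning tree with edge set `F`: the number of vertices
of `G₁` which are connected to `T` once the edge `TR` is cut. This is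
also the number of edges of the TI-tree, not counting the edge `TR`. -/
noncomputable def tiLength (n m : ℕ) (F : Set (Option (Sym2 (ℤ × ℤ)))) : ℕ :=
  {p : ℤ × ℤ | p ∈ gridVertices n m ∧
    (((gridTR n m).restrict F).deleteEdges {none}).Reaches .terminal (.site p)}.ncard

/-- `E[l_T]`, the expectation for the uniform distribution on the (finite) set of spanning
trees. -/
noncomputable def expectedTILength (n m : ℕ) : ℝ :=
  (∑ᶠ F ∈ tiSpanningTrees n m, (tiLength n m F : ℝ)) / ((tiSpanningTrees n m).ncard : ℝ)

/-- The integrand `sin(θx) sin(φy) sin θ sin φ / (2 - cos θ - cos φ)`, at `z = (θ, φ)`. -/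
noncomputable def greenIntegrand (x y : ℤ) (z : ℝ × ℝ) : ℝ :=
  Real.sin (z.1 * x) * Real.sin (z.2 * y) * Real.sin z.1 * Real.sin z.2 /
    (2 - Real.cos z.1 - Real.cos z.2)

/-!
Let `N v` be the number of spanning trees through `TR` in which `v` belongs to the TI-tree. In a
pair of such a tree and an edge `vw`, with `v` a vertex of the grid, replace the parent edge of `v`
by `vw`, unless `w` descends from `v`. Remembering the old parent edge makes this an involution,
which exchanges the pairs with `v` in the TI-tree and those with `w` in the TI-tree. Hence `N` is
harmonic on the grid, with boundary values `N T = τ`, the number of all these trees, and `N R = 0`,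
so that `K N = τ δ_(1,1)`, and the expected length `(∑ N v) / τ` is a sum of entries of `A = K⁻¹`.

The matrix `K` is diagonalised by products of sines. This displays the entries `A(p, (1,1))` as
Riemann sums of the integrand of the limit, which is continuous since its singularity at the origin
is removable once it is given the value `0`. Summing over `p` leaves the frequencies `(a, b)` with
both indices odd, where the summand differs by a bounded amount from `8 / (a² + b²)`. Up to summable
errors, the sum of these along the longer side of the grid is an arctangent integral, inversely
proportional to the other frequency, and the remaining sum of inverses of odd numbers is
logarithmic.
-/

section Multigraph

variable {α β : Type*} {G : Graph α β} {F F' : Set β} {u v w a b t r : α} {e f g o : β}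

/-! ### Connection by a set of edges -/

/-- The vertices `u` and `v` are joined by a path of the multigraph `G` all of whose edges lie
in `F`. -/
def JoinedBy (G : Graph α β) (F : Set β) (u v : α) : Prop :=
  (G.restrict F).Reaches u v

lemma reaches_deleteEdges_restrict_iff {S : Set β} :
    ((G.restrict F).deleteEdges S).Reaches u v ↔ JoinedBy G (F \ S) u v := by
  have adj_eq : ((G.restrict F).deleteEdges S).Adj = (G.restrict (F \ S)).Adj := by
    ext x y
    simp only [Graph.Adj, Graph.deleteEdges_isLink, Graph.restrict_isLink, Set.mem_sdiff]
    exact exists_congr fun e => by tauto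
  rw [JoinedBy, Graph.Reaches, Graph.Reaches, adj_eq]

namespace JoinedBy

lemma refl (u : α) : JoinedBy G F u u := Relation.ReflTransGen.refl

lemma trans (h : JoinedBy G F u v) (h' : JoinedBy G F v w) : JoinedBy G F u w :=
  Relation.ReflTransGen.trans h h'

lemma of_isLink (he : e ∈ F) (h : G.IsLink e u v) : JoinedBy G F u v :=
  Relation.ReflTransGen.single ⟨e, he, h⟩

lemma of_forall_isLink (hF : ∀ e ∈ F, ∀ x y, G.IsLink e x y → JoinedBy G F' x y)
    (h : JoinedBy G F u v) : JoinedBy G F' u v := by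
  induction h with
  | refl => exact refl _
  | tail _ h ih =>
    obtain ⟨e, he, hl⟩ := h
    exact ih.trans (hF e he _ _ hl)

lemma mono (hF : F ⊆ F') (h : JoinedBy G F u v) : JoinedBy G F' u v :=
  h.of_forall_isLink fun _ he _ _ hl => of_isLink (hF he) hl

lemma symm (h : JoinedBy G F u v) : JoinedBy G F v u := by
  induction h with
  | refl => exact refl _
  | tail _ h ih =>
    obtain ⟨e, he, hl⟩ := h
    exact (of_isLink he hl.symm).trans ih

end JoinedBy

lemma joinedBy_insert_iff (hf : G.IsLink f a b) :
    JoinedBy G (insert f F) u v ↔ JoinedBy G F u v ∨ (JoinedBy G F u a ∧ JoinedBy G F b v) ∨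
      (JoinedBy G F u b ∧ JoinedBy G F a v) := by
  have hF : F ⊆ insert f F := subset_insert f F
  have hab : JoinedBy G (insert f F) a b := .of_isLink (mem_insert f F) hf
  constructor
  · intro h
    induction h with
    | refl => exact Or.inl (.refl _)
    | @tail x y _ h ih =>
      obtain ⟨e, rfl | he, hl⟩ := h
      · have := JoinedBy.refl (G := G) (F := F) a
        have := JoinedBy.refl (G := G) (F := F) b
        rcases hf.eq_and_eq_or_eq_and_eq hl with ⟨rfl, rfl⟩ | ⟨rfl, rfl⟩ <;> tauto
      · have extend {z : α} (hz : JoinedBy G F z x) : JoinedBy G F z y :=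
          hz.trans (.of_isLink he hl)
        exact ih.imp extend (.imp (.imp_right extend) (.imp_right extend))
  · rintro (h | ⟨hua, hbv⟩ | ⟨hub, hav⟩)
    · exact h.mono hF
    · exact ((hua.mono hF).trans hab).trans (hbv.mono hF)
    · exact ((hub.mono hF).trans hab.symm).trans (hav.mono hF)

lemma joinedBy_iff_sdiff (hf : G.IsLink f a b) (hfF : f ∈ F) :
    JoinedBy G F u v ↔ JoinedBy G (F \ {f}) u v ∨
      (JoinedBy G (F \ {f}) u a ∧ JoinedBy G (F \ {f}) b v) ∨
      (JoinedBy G (F \ {f}) u b ∧ JoinedBy G (F \ {f}) a v) := by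
  rw [← joinedBy_insert_iff hf, insert_sdiff_self_of_mem hfF]

lemma JoinedBy.eq_of_forall_not_inc (h : JoinedBy G F v u) (hF : ∀ e ∈ F, ¬ G.Inc e v) :
    v = u := by
  rcases Relation.ReflTransGen.cases_head h with rfl | ⟨y, ⟨e, he, hl⟩, -⟩
  exacts [rfl, absurd ⟨y, hl⟩ (hF e he)]

/-- Cut a path at its last visit to `v`. -/
lemma JoinedBy.avoid_or_last_exit (h : JoinedBy G F u r) (hvr : v ≠ r) :
    JoinedBy G (F \ {e | G.Inc e v}) u r ∨
      ∃ e ∈ F, ∃ w, G.IsLink e v w ∧ JoinedBy G (F \ {e | G.Inc e v}) w r := by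
  induction h using Relation.ReflTransGen.head_induction_on with
  | refl => exact Or.inl (.refl _)
  | @head x y hxy _ ih =>
    obtain ⟨e, he, hl⟩ := hxy
    rcases ih with hy | hexit
    · by_cases hxv : x = v
      · exact Or.inr ⟨e, he, y, hxv ▸ hl, hy⟩
      have hyv : y ≠ v := by
        rintro rfl
        exact hvr (hy.eq_of_forall_not_inc fun _ he => he.2)
      have hev : ¬ G.Inc e v := fun hi =>
        (hi.eq_or_eq_of_isLink hl).elim (fun h => hxv h.symm) fun h => hyv h.symm
      exact Or.inl ((JoinedBy.of_isLink (F := F \ {e | G.Inc e v}) ⟨he, hev⟩ hl).trans hy)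
    · exact Or.inr hexit

/-! ### Spanning forests and spanning trees -/

/-- The edge set `F` is acyclic: no edge of `F` joins vertices that are still joined after its
removal. -/
def IsForest (G : Graph α β) (F : Set β) : Prop :=
  ∀ e ∈ F, ∀ u v, G.IsLink e u v → ¬ JoinedBy G (F \ {e}) u v

lemma IsForest.subset (h : IsForest G F) (hF : F' ⊆ F) : IsForest G F' :=
  fun e he u v hl hj => h e (hF he) u v hl (hj.mono (sdiff_subset_sdiff_left hF))

lemma isForest_singleton (ho : G.IsLink o t r) (htr : t ≠ r) : IsForest G {o} := by
  rintro e rfl u v hl hj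
  rw [sdiff_self] at hj
  obtain rfl : u = v := hj.eq_of_forall_not_inc fun _ he => he.elim
  rcases ho.eq_and_eq_or_eq_and_eq hl with ⟨rfl, rfl⟩ | ⟨rfl, rfl⟩ <;> exact htr rfl

lemma IsForest.insert (h : IsForest G F) (hf : G.IsLink f a b) (hab : ¬ JoinedBy G F a b) :
    IsForest G (insert f F) := by
  have hfF : f ∉ F := fun hfF => hab (.of_isLink hfF hf)
  rintro e (rfl | he) u v hl
  · rw [insert_sdiff_self_of_notMem hfF]
    rcases hf.eq_and_eq_or_eq_and_eq hl with ⟨rfl, rfl⟩ | ⟨rfl, rfl⟩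
    exacts [hab, fun h => hab h.symm]
  · have huv : JoinedBy G F u v := .of_isLink he hl
    have hF : F \ {e} ⊆ F := sdiff_subset
    have hfe : f ∉ ({e} : Set β) := by rintro rfl; exact hfF he
    rw [insert_sdiff_of_notMem _ hfe, joinedBy_insert_iff hf]
    rintro (hj | ⟨hua, hbv⟩ | ⟨hub, hav⟩)
    · exact h e he u v hl hj
    · exact hab (((hua.mono hF).symm.trans huv).trans (hbv.mono hF).symm)
    · exact hab (((hav.mono hF).trans huv.symm).trans (hub.mono hF))

lemma isSpanningTree_iff : G.IsSpanningTree F ↔ F ⊆ G.edgeSet ∧ G.vertexSet.Nonempty ∧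
    (∀ u ∈ G.vertexSet, ∀ v ∈ G.vertexSet, JoinedBy G F u v) ∧ IsForest G F := by
  constructor
  · rintro ⟨hF, hne, hconn, hbridge⟩
    exact ⟨hF, hne, hconn, fun e he u v hl hj =>
      hbridge e u v ⟨he, hl⟩ (reaches_deleteEdges_restrict_iff.2 hj)⟩
  · rintro ⟨hF, hne, hconn, hforest⟩
    exact ⟨hF, hne, hconn, fun e u v hl hj =>
      hforest e hl.1 u v hl.2 (reaches_deleteEdges_restrict_iff.1 hj)⟩

lemma joinedBy_of_isSpanningTree (h : G.IsSpanningTree F) (hu : u ∈ G.vertexSet)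
    (hv : v ∈ G.vertexSet) : JoinedBy G F u v :=
  h.2.connected u hu v hv

lemma isForest_of_isSpanningTree (h : G.IsSpanningTree F) : IsForest G F :=
  (isSpanningTree_iff.1 h).2.2.2

lemma isSpanningTree_insert_sdiff (h : G.IsSpanningTree F) (hg : g ∈ F) (hgl : G.IsLink g a b)
    (hf : G.IsLink f u v) (hu : JoinedBy G (F \ {g}) u a) (hv : JoinedBy G (F \ {g}) v b) :
    G.IsSpanningTree (insert f (F \ {g})) := by
  have hforest := isForest_of_isSpanningTree h
  have huv : ¬ JoinedBy G (F \ {g}) u v := fun hj =>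
    hforest g hg a b hgl ((hu.symm.trans hj).trans hv)
  have hab : JoinedBy G (insert f (F \ {g})) a b :=
    (joinedBy_insert_iff hf).2 (.inr (.inl ⟨hu.symm, hv⟩))
  refine isSpanningTree_iff.2 ⟨insert_subset hf.edge_mem (sdiff_subset.trans h.1), h.2.nonempty,
    fun x hx y hy => ?_, (hforest.subset sdiff_subset).insert hf huv⟩
  refine (joinedBy_of_isSpanningTree h hx hy).of_forall_isLink fun e he c d hcd => ?_
  by_cases heg : e = g
  · subst heg
    rcases hgl.eq_and_eq_or_eq_and_eq hcd with ⟨rfl, rfl⟩ | ⟨rfl, rfl⟩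
    exacts [hab, hab.symm]
  · exact .of_isLink (mem_insert_of_mem _ ⟨he, heg⟩) hcd

/-- The set of the spanning trees of `G`, given by their edge sets, which contain the edge `o`. -/
def spanningTreesThrough (G : Graph α β) (o : β) : Set (Set β) :=
  {F | G.IsSpanningTree F ∧ o ∈ F}

lemma finite_spanningTreesThrough (hfin : G.edgeSet.Finite) :
    (spanningTreesThrough G o).Finite :=
  hfin.finite_subsets.subset fun _ hF => hF.1.1

lemma nonempty_spanningTreesThrough (hfin : G.edgeSet.Finite)
    (hconn : ∀ u ∈ G.vertexSet, ∀ v ∈ G.vertexSet, JoinedBy G G.edgeSet u v)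
    (ho : G.IsLink o t r) (htr : t ≠ r) : (spanningTreesThrough G o).Nonempty := by
  have hfinite : {F | F ⊆ G.edgeSet ∧ o ∈ F ∧ IsForest G F}.Finite :=
    hfin.finite_subsets.subset fun F hF => hF.1
  obtain ⟨F, ⟨hFE, hoF, hforest⟩, hmax⟩ := hfinite.exists_maximal
    ⟨{o}, by simpa using ho.edge_mem, rfl, isForest_singleton ho htr⟩
  refine ⟨F, isSpanningTree_iff.2 ⟨hFE, ⟨t, ho.left_mem⟩, fun u hu v hv => ?_, hforest⟩, hoF⟩
  refine (hconn u hu v hv).of_forall_isLink fun f _ a b hf => ?_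
  by_contra hab
  have hfF : f ∈ F := hmax ⟨insert_subset hf.edge_mem hFE, mem_insert_of_mem _ hoF,
    hforest.insert hf hab⟩ (subset_insert _ _) (mem_insert _ _)
  exact hab (.of_isLink hfF hf)

/-! ### Parents -/

/-- In the spanning tree with edge set `F` rooted at `r`, the pair `x = (e, w)` consists of the
first edge `e` on the way from `v` to `r` and of its end `w`, the parent of `v`: cutting `e`
separates `v` from `r`. -/
structure IsParent (G : Graph α β) (F : Set β) (r v : α) (x : β × α) : Prop where
  mem : x.1 ∈ F
  isLink : G.IsLink x.1 v x.2
  not_joinedBy : ¬ JoinedBy G (F \ {x.1}) v r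

lemma exists_isParent (h : G.IsSpanningTree F) (hv : v ∈ G.vertexSet) (hr : r ∈ G.vertexSet)
    (hvr : v ≠ r) : ∃ x, IsParent G F r v x := by
  rcases (joinedBy_of_isSpanningTree h hv hr).avoid_or_last_exit hvr with
    hj | ⟨e, he, w, hl, hw⟩
  · exact absurd (hj.eq_of_forall_not_inc fun _ he => he.2) hvr
  · refine ⟨(e, w), he, hl, fun hj => isForest_of_isSpanningTree h e he v w hl ?_⟩
    have hsub : F \ {e | G.Inc e v} ⊆ F \ {e} :=
      sdiff_subset_sdiff_right (singleton_subset_iff.2 ⟨w, hl⟩)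
    exact hj.trans (hw.mono hsub).symm

namespace IsParent

variable {x y : β × α}

lemma joinedBy (hx : IsParent G F r v x) (h : JoinedBy G F v r) :
    JoinedBy G (F \ {x.1}) x.2 r := by
  rcases (joinedBy_iff_sdiff hx.isLink hx.mem).1 h with hj | hj | hj
  exacts [absurd hj hx.not_joinedBy, hj.2, absurd hj.2 hx.not_joinedBy]

lemma unique (hx : IsParent G F r v x) (hy : IsParent G F r v y) (h : JoinedBy G F v r) :
    x = y := by
  have hxy : x.1 = y.1 := by
    by_contra hne
    have hyF : y.1 ∈ F \ {x.1} := ⟨hy.mem, Ne.symm hne⟩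
    have hvy : JoinedBy G (F \ {x.1}) v y.2 := .of_isLink hyF hy.isLink
    have hvx : JoinedBy G (F \ {y.1}) v x.2 := .of_isLink ⟨hx.mem, hne⟩ hx.isLink
    have hsub : (F \ {x.1}) \ {y.1} ⊆ F \ {y.1} := sdiff_subset_sdiff_left sdiff_subset
    rcases (joinedBy_iff_sdiff hy.isLink hyF).1 (hx.joinedBy h) with hj | hj | hj
    · exact hy.not_joinedBy (hvx.trans (hj.mono hsub))
    · exact hx.not_joinedBy (hvy.trans (hj.2.mono sdiff_subset))
    · exact hx.not_joinedBy (hj.2.mono sdiff_subset)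
  exact Prod.ext hxy (hx.isLink.right_unique (hxy ▸ hy.isLink))

end IsParent

/-! ### Counting branches of spanning trees -/

/-- The number of spanning trees containing the edge `o` in which the vertex `v` is still joined
to the vertex `t` after `o` is cut. -/
noncomputable def branchCount (G : Graph α β) (o : β) (t v : α) : ℕ :=
  {F | F ∈ spanningTreesThrough G o ∧ JoinedBy G (F \ {o}) t v}.ncard

lemma branchCount_self : branchCount G o t t = (spanningTreesThrough G o).ncard := by
  simp only [branchCount, JoinedBy.refl, and_true, ofPred_mem_eq]

lemma branchCount_eq_zero (ho : G.IsLink o t r) : branchCount G o t r = 0 := by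
  have hempty : {F | F ∈ spanningTreesThrough G o ∧ JoinedBy G (F \ {o}) t r} = ∅ :=
    eq_empty_of_forall_notMem fun F hF =>
      isForest_of_isSpanningTree hF.1.1 o hF.1.2 t r ho hF.2
  rw [branchCount, hempty, ncard_empty]

open Classical in
lemma branchCount_eq_sum (h : (spanningTreesThrough G o).Finite) (w : α) :
    (branchCount G o t w : ℝ) =
      ∑ F ∈ h.toFinset, if JoinedBy G (F \ {o}) t w then (1 : ℝ) else 0 := by
  rw [Finset.sum_boole, branchCount, ← ncard_coe_finset, Finset.coe_filter]
  simp only [Finite.mem_toFinset]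

lemma graphLaplacian_eq_sum {D : Finset (β × α)} (hD : ∀ x, x ∈ D ↔ G.IsLink x.1 v x.2)
    (f : α → ℝ) : graphLaplacian G f v = ∑ x ∈ D, (f v - f x.2) := by
  classical
  have hmult (w : α) : edgeMultiplicity G v w = (D.filter fun x => x.2 = w).card := by
    rw [edgeMultiplicity, ← ncard_coe_finset]
    refine ncard_congr (fun e _ => (e, w)) (fun e he => ?_) (fun _ _ _ _ h => congrArg Prod.fst h)
      fun x hx => ?_
    · simpa [hD] using he
    · obtain ⟨hxD, rfl⟩ := Finset.mem_filter.1 hx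
      exact ⟨x.1, (hD x).1 hxD, rfl⟩
  rw [Finset.sum_comp (fun w => f v - f w) Prod.snd, graphLaplacian]
  simp only [nsmul_eq_mul, ← hmult]
  refine finsum_mem_eq_sum_of_inter_support_eq _ (Set.ext fun w => and_congr_left fun hw => ?_)
  have hpos : edgeMultiplicity G v w ≠ 0 := fun h => hw (by simp [h])
  rw [hmult, Finset.card_ne_zero] at hpos
  obtain ⟨x, hx⟩ := hpos
  obtain ⟨hxD, rfl⟩ := Finset.mem_filter.1 hx
  exact iff_of_true ((hD x).1 hxD).right_mem (Finset.mem_coe.2 (Finset.mem_image_of_mem _ hxD))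

/-! ### Rerooting at a vertex -/

namespace IsParent

variable {x y : β × α}

lemma joinedBy_or (hy : IsParent G F r v y) (h : G.IsSpanningTree F) (hw : w ∈ G.vertexSet)
    (hr : r ∈ G.vertexSet) : JoinedBy G (F \ {y.1}) w v ∨ JoinedBy G (F \ {y.1}) w r := by
  have hyr := hy.joinedBy (joinedBy_of_isSpanningTree h hy.isLink.left_mem hr)
  rcases (joinedBy_iff_sdiff hy.isLink hy.mem).1 (joinedBy_of_isSpanningTree h hw hr) with
    hj | hj | hj
  exacts [.inr hj, .inl hj.1, .inr (hj.1.trans hyr)]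

lemma ne_of_not_inc (hy : IsParent G F r v y) (hov : ¬ G.Inc o v) : o ≠ y.1 :=
  fun h => hov ⟨y.2, h ▸ hy.isLink⟩

lemma insert_mem_spanningTreesThrough (hy : IsParent G F r v y)
    (hF : F ∈ spanningTreesThrough G o) (hov : ¬ G.Inc o v) (hr : r ∈ G.vertexSet)
    (hx : G.IsLink x.1 v x.2) (hxv : ¬ JoinedBy G (F \ {y.1}) x.2 v) :
    insert x.1 (F \ {y.1}) ∈ spanningTreesThrough G o := by
  have hyr := hy.joinedBy (joinedBy_of_isSpanningTree hF.1 hy.isLink.left_mem hr)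
  have hxr := (hy.joinedBy_or hF.1 hx.right_mem hr).resolve_left hxv
  exact ⟨isSpanningTree_insert_sdiff hF.1 hy.mem hy.isLink hx (.refl v) (hxr.trans hyr.symm),
    Or.inr ⟨hF.2, hy.ne_of_not_inc hov⟩⟩

lemma insert_sdiff (hy : IsParent G F r v y) (hx : G.IsLink x.1 v x.2) :
    IsParent G (insert x.1 (F \ {y.1})) r v x :=
  ⟨mem_insert _ _, hx, fun hj => hy.not_joinedBy (hj.mono (by simp))⟩

/-- A vertex which descends from `v` lies in the same branch as `v`: the path between them avoids
the edge `o` at the root. -/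
lemma joinedBy_sdiff_of_joinedBy (hy : IsParent G F r v y) (hF : F ∈ spanningTreesThrough G o)
    (ho : G.IsLink o t r) (hov : ¬ G.Inc o v) (hwv : JoinedBy G (F \ {y.1}) w v) :
    JoinedBy G (F \ {o}) w v := by
  have hoF : o ∈ F \ {y.1} := ⟨hF.2, hy.ne_of_not_inc hov⟩
  have htr : JoinedBy G (F \ {y.1}) t r := .of_isLink hoF ho
  have hsub : (F \ {y.1}) \ {o} ⊆ F \ {y.1} := sdiff_subset
  rcases (joinedBy_iff_sdiff ho hoF).1 hwv with hj | hj | hj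
  · exact hj.mono (sdiff_subset_sdiff_left sdiff_subset)
  · exact absurd (hj.2.mono hsub).symm hy.not_joinedBy
  · exact absurd ((hj.2.mono hsub).symm.trans htr) hy.not_joinedBy

/-- Every vertex lies in the same branch as its parent, and after `v` has moved to the parent `x.2`
the branch of its old parent `y.2` is unchanged. -/
lemma joinedBy_iff_insert (hy : IsParent G F r v y) (hF : F ∈ spanningTreesThrough G o)
    (ho : G.IsLink o t r) (hov : ¬ G.Inc o v) (hx : G.IsLink x.1 v x.2) :
    JoinedBy G (F \ {o}) t v ↔ JoinedBy G (insert x.1 (F \ {y.1}) \ {o}) t y.2 := by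
  have hoy := hy.ne_of_not_inc hov
  have hox : o ≠ x.1 := fun h => hov ⟨x.2, h ▸ hx⟩
  set H := (F \ {y.1}) \ {o} with hH
  have hHF : H ⊆ F \ {y.1} := sdiff_subset
  have hF_eq : F \ {o} = insert y.1 H := by
    have hyF : y.1 ∈ F \ {o} := ⟨hy.mem, hoy.symm⟩
    rw [hH, sdiff_sdiff_comm, insert_sdiff_self_of_mem hyF]
  have hF'_eq : insert x.1 (F \ {y.1}) \ {o} = insert x.1 H :=
    insert_sdiff_of_notMem _ fun h => hox (mem_singleton_iff.1 h).symm
  have hoF : o ∈ F \ {y.1} := ⟨hF.2, hoy⟩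
  have htv : ¬ JoinedBy G H t v := fun hj =>
    hy.not_joinedBy ((hj.mono hHF).symm.trans (.of_isLink hoF ho))
  have hvy : ¬ JoinedBy G H v y.2 := fun hj =>
    isForest_of_isSpanningTree hF.1 y.1 hy.mem v y.2 hy.isLink (hj.mono hHF)
  have hvv : JoinedBy G H v v := .refl v
  rw [hF_eq, hF'_eq, joinedBy_insert_iff hy.isLink, joinedBy_insert_iff hx]
  tauto

end IsParent

open Classical in
/-- The rerooting move at the vertex `v`. Given an edge `p.1.1` from `v` to `p.1.2` and a tree with
edge set `p.2`, in which `par p.2` is the pair of the parent edge and the parent of `v`, exchange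
the parent edge with the given edge; do nothing if this would close a cycle, that is, if `p.1.2`
descends from `v`. -/
noncomputable def reroot (G : Graph α β) (v : α) (par : Set β → β × α)
    (p : (β × α) × Set β) : (β × α) × Set β :=
  if JoinedBy G (p.2 \ {(par p.2).1}) p.1.2 v then p
  else (par p.2, insert p.1.1 (p.2 \ {(par p.2).1}))

section Reroot

variable {par : Set β → β × α} {p : (β × α) × Set β}
  (ho : G.IsLink o t r) (hov : ¬ G.Inc o v)
  (hpar : ∀ F ∈ spanningTreesThrough G o, IsParent G F r v (par F))
  (hlink : G.IsLink p.1.1 v p.1.2) (htree : p.2 ∈ spanningTreesThrough G o)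

include ho hov hpar hlink htree

lemma reroot_mem_spanningTreesThrough : (reroot G v par p).2 ∈ spanningTreesThrough G o := by
  unfold reroot
  split_ifs with h
  exacts [htree, (hpar _ htree).insert_mem_spanningTreesThrough htree hov ho.right_mem hlink h]

omit ho hov in
lemma isLink_reroot : G.IsLink (reroot G v par p).1.1 v (reroot G v par p).1.2 := by
  unfold reroot
  split_ifs
  exacts [hlink, (hpar _ htree).isLink]

lemma reroot_reroot : reroot G v par (reroot G v par p) = p := by
  by_cases h : JoinedBy G (p.2 \ {(par p.2).1}) p.1.2 v
  · have hfix : reroot G v par p = p := if_pos h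
    rw [hfix, hfix]
  have hy := hpar _ htree
  have hF' := hy.insert_mem_spanningTreesThrough htree hov ho.right_mem hlink h
  have hjoin {F : Set β} (hF : F ∈ spanningTreesThrough G o) : JoinedBy G F v r :=
    joinedBy_of_isSpanningTree hF.1 hlink.left_mem ho.right_mem
  have hpar' : par (insert p.1.1 (p.2 \ {(par p.2).1})) = p.1 :=
    (hpar _ hF').unique (hy.insert_sdiff hlink) (hjoin hF')
  have hnotMem : p.1.1 ∉ p.2 \ {(par p.2).1} := fun hmem => h (.of_isLink hmem hlink.symm)
  have hback : ¬ JoinedBy G (p.2 \ {(par p.2).1}) (par p.2).2 v := fun hj =>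
    hy.not_joinedBy (hj.symm.trans (hy.joinedBy (hjoin htree)))
  have hmove : reroot G v par p = (par p.2, insert p.1.1 (p.2 \ {(par p.2).1})) := if_neg h
  rw [hmove]
  simp only [reroot, hpar', insert_sdiff_self_of_notMem hnotMem, insert_sdiff_self_of_mem hy.mem]
  exact if_neg (by rwa [hpar', insert_sdiff_self_of_notMem hnotMem])

lemma joinedBy_reroot_iff :
    JoinedBy G ((reroot G v par p).2 \ {o}) t (reroot G v par p).1.2 ↔
      JoinedBy G (p.2 \ {o}) t v := by
  unfold reroot
  split_ifs with h
  · have hj := (hpar _ htree).joinedBy_sdiff_of_joinedBy htree ho hov h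
    exact ⟨fun h' => h'.trans hj, fun h' => h'.trans hj.symm⟩
  · exact ((hpar _ htree).joinedBy_iff_insert htree ho hov hlink).symm

end Reroot

theorem graphLaplacian_branchCount_eq_zero (hfin : G.edgeSet.Finite) (ho : G.IsLink o t r)
    (hv : v ∈ G.vertexSet) (hvt : v ≠ t) (hvr : v ≠ r) :
    graphLaplacian G (fun w => branchCount G o t w) v = 0 := by
  classical
  have hov : ¬ G.Inc o v := fun hi => (hi.eq_or_eq_of_isLink ho).elim hvt hvr
  have : Nonempty (β × α) := ⟨(o, v)⟩
  choose! par hpar using fun F (hF : F ∈ spanningTreesThrough G o) =>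
    exists_isParent hF.1 hv ho.right_mem hvr
  have hdarts : {x : β × α | G.IsLink x.1 v x.2}.Finite := by
    refine Finite.of_finite_image (hfin.subset ?_) (f := Prod.fst) fun x hx y hy hxy =>
      Prod.ext hxy (Graph.IsLink.right_unique hx (hxy ▸ hy))
    rintro _ ⟨x, hx, rfl⟩
    exact hx.edge_mem
  have htrees := finite_spanningTreesThrough (o := o) hfin
  rw [graphLaplacian_eq_sum (D := hdarts.toFinset) (by simp), Finset.sum_sub_distrib, sub_eq_zero]
  simp only [branchCount_eq_sum htrees, ← Finset.sum_product']
  refine Finset.sum_nbij' (reroot G v par) (reroot G v par) ?_ ?_ ?_ ?_ ?_ <;>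
    intro p hp <;> obtain ⟨hlink, htree⟩ : G.IsLink p.1.1 v p.1.2 ∧ _ := by simpa using hp
  iterate 2
    exact Finset.mem_product.2
      ⟨hdarts.mem_toFinset.2 (isLink_reroot hpar hlink htree),
        htrees.mem_toFinset.2 (reroot_mem_spanningTreesThrough ho hov hpar hlink htree)⟩
  iterate 2 exact reroot_reroot ho hov hpar hlink htree
  simp only [joinedBy_reroot_iff ho hov hpar hlink htree]

end Multigraph

/-! ### The grid with its terminal and its root -/

/-- The four nearest neighbours of a lattice site, in a form suited to summation. -/
def latticeNeighbors (p : ℤ × ℤ) : Finset (ℤ × ℤ) :=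
  {(p.1 + 1, p.2), (p.1 - 1, p.2), (p.1, p.2 + 1), (p.1, p.2 - 1)}

lemma LatticeAdj.symm {p q : ℤ × ℤ} (h : LatticeAdj p q) : LatticeAdj q p := by
  rw [LatticeAdj] at *
  rwa [abs_sub_comm q.1, abs_sub_comm q.2]

lemma mem_latticeNeighbors {p q : ℤ × ℤ} : q ∈ latticeNeighbors p ↔ LatticeAdj p q := by
  obtain ⟨a, b⟩ := p
  obtain ⟨c, d⟩ := q
  simp only [latticeNeighbors, LatticeAdj, Finset.mem_insert, Finset.mem_singleton, Prod.mk.injEq]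
  grind

lemma sum_latticeNeighbors {M : Type*} [AddCommMonoid M] (p : ℤ × ℤ) (f : ℤ × ℤ → M) :
    ∑ q ∈ latticeNeighbors p, f q =
      f (p.1 + 1, p.2) + (f (p.1 - 1, p.2) + (f (p.1, p.2 + 1) + f (p.1, p.2 - 1))) := by
  unfold latticeNeighbors
  rw [Finset.sum_insert, Finset.sum_insert, Finset.sum_insert, Finset.sum_singleton]
  all_goals simp only [Finset.mem_insert, Finset.mem_singleton, Prod.mk.injEq]; omega

section Grid

variable {n m : ℕ} {p q : ℤ × ℤ} {e : Option (Sym2 (ℤ × ℤ))} {v w : GridVertex}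

lemma mem_gridVertices : p ∈ gridVertices n m ↔ (1 ≤ p.1 ∧ p.1 ≤ n) ∧ (1 ≤ p.2 ∧ p.2 ≤ m) := by
  simp only [gridVertices, Finset.mem_product, Finset.mem_Icc]

lemma one_one_mem_gridVertices (hn : 1 ≤ n) (hm : 1 ≤ m) : (1, 1) ∈ gridVertices n m :=
  mem_gridVertices.2 ⟨⟨le_rfl, Int.ofNat_le.2 hn⟩, le_rfl, Int.ofNat_le.2 hm⟩

lemma zero_one_notMem_gridVertices : ((0, 1) : ℤ × ℤ) ∉ gridVertices n m := by
  simp [mem_gridVertices]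

lemma gridEndpoint_of_mem (hp : p ∈ gridVertices n m) : gridEndpoint n m p = .site p :=
  if_pos hp

lemma gridEndpoint_zero_one : gridEndpoint n m (0, 1) = .terminal := by
  rw [gridEndpoint, if_neg zero_one_notMem_gridVertices, if_pos rfl]

lemma gridEndpoint_of_notMem (hq : q ∉ gridVertices n m) (h : q ≠ (0, 1)) :
    gridEndpoint n m q = .root := by
  rw [gridEndpoint, if_neg hq, if_neg h]

lemma gridEndpoint_eq_site_iff : gridEndpoint n m q = .site p ↔ q = p ∧ q ∈ gridVertices n m := by
  unfold gridEndpoint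
  split_ifs with hq <;> simp [hq]

lemma isLink_gridTR_none : (gridTR n m).IsLink none .terminal .root :=
  Or.inl ⟨rfl, Or.inl ⟨rfl, rfl⟩⟩

lemma isLink_gridTR_gridEndpoint (hp : p ∈ gridVertices n m) (hpq : LatticeAdj p q) :
    (gridTR n m).IsLink (some s(p, q)) (gridEndpoint n m p) (gridEndpoint n m q) :=
  Or.inr ⟨p, q, rfl, hpq, Or.inl hp, rfl, rfl⟩

lemma isLink_gridTR_site_iff (hp : p ∈ gridVertices n m) :
    (gridTR n m).IsLink e (.site p) w ↔
      ∃ q ∈ latticeNeighbors p, some s(p, q) = e ∧ gridEndpoint n m q = w := by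
  constructor
  · rintro (⟨-, ⟨h, -⟩ | ⟨h, -⟩⟩ | ⟨p', q, rfl, hpq, -, hv, rfl⟩)
    · cases h
    · cases h
    · obtain ⟨rfl, -⟩ := gridEndpoint_eq_site_iff.1 hv.symm
      exact ⟨q, mem_latticeNeighbors.2 hpq, rfl, rfl⟩
  · rintro ⟨q, hq, rfl, rfl⟩
    rw [← gridEndpoint_of_mem hp]
    exact isLink_gridTR_gridEndpoint hp (mem_latticeNeighbors.1 hq)

lemma finite_edgeSet_gridTR : (gridTR n m).edgeSet.Finite := by
  classical
  have hfinite : (⋃ p ∈ gridVertices n m,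
      ((latticeNeighbors p).image fun q => some s(p, q) : Set (Option (Sym2 (ℤ × ℤ))))).Finite :=
    (gridVertices n m).finite_toSet.biUnion fun p _ => Finset.finite_toSet _
  refine (hfinite.insert none).subset fun e he => ?_
  obtain ⟨x, y, ⟨rfl, -⟩ | ⟨p, q, rfl, hpq, hp | hq, -, -⟩⟩ :=
    (gridTR n m).exists_isLink_of_mem_edgeSet he
  · exact mem_insert _ _
  · refine Or.inr (mem_biUnion hp (Finset.mem_coe.2 ?_))
    exact Finset.mem_image_of_mem _ (mem_latticeNeighbors.2 hpq)
  · refine Or.inr (mem_biUnion hq (Finset.mem_coe.2 ?_))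
    rw [Sym2.eq_swap]
    exact Finset.mem_image_of_mem _ (mem_latticeNeighbors.2 hpq.symm)

/-- Walk to the right until the grid is left. -/
lemma joinedBy_gridEndpoint_root (p : ℤ × ℤ) (hp : 1 ≤ p.1) :
    JoinedBy (gridTR n m) (gridTR n m).edgeSet (gridEndpoint n m p) .root := by
  by_cases hmem : p ∈ gridVertices n m
  · have hlink := isLink_gridTR_gridEndpoint hmem (q := (p.1 + 1, p.2)) (by simp [LatticeAdj])
    have hright : 1 ≤ p.1 + 1 := by omega
    exact (JoinedBy.of_isLink hlink.edge_mem hlink).trans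
      (joinedBy_gridEndpoint_root (p.1 + 1, p.2) hright)
  · rw [gridEndpoint_of_notMem hmem (by rintro rfl; simp at hp)]
    exact .refl _
termination_by (n + 1 - p.1).toNat
decreasing_by
  have := mem_gridVertices.1 hmem
  omega

lemma joinedBy_edgeSet_gridTR_root (hv : v ∈ (gridTR n m).vertexSet) :
    JoinedBy (gridTR n m) (gridTR n m).edgeSet v .root := by
  rcases hv with ⟨p, hp, rfl⟩ | rfl | rfl
  · rw [← gridEndpoint_of_mem hp]
    exact joinedBy_gridEndpoint_root p (mem_gridVertices.1 hp).1.1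
  · exact .of_isLink isLink_gridTR_none.edge_mem isLink_gridTR_none
  · exact .refl _

lemma tiSpanningTrees_eq_spanningTreesThrough :
    tiSpanningTrees n m = spanningTreesThrough (gridTR n m) none := rfl

lemma finite_tiSpanningTrees : (tiSpanningTrees n m).Finite :=
  finite_spanningTreesThrough finite_edgeSet_gridTR

lemma nonempty_tiSpanningTrees : (tiSpanningTrees n m).Nonempty :=
  nonempty_spanningTreesThrough finite_edgeSet_gridTR
    (fun _ hu _ hv =>
      (joinedBy_edgeSet_gridTR_root hu).trans (joinedBy_edgeSet_gridTR_root hv).symm)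
    isLink_gridTR_none (by simp)

/-! ### The Laplacian of the grid and the law of the TI-tree -/

lemma graphLaplacian_gridTR_site (hp : p ∈ gridVertices n m) (f : GridVertex → ℝ) :
    graphLaplacian (gridTR n m) f (.site p) =
      ∑ q ∈ latticeNeighbors p, (f (.site p) - f (gridEndpoint n m q)) := by
  classical
  rw [graphLaplacian_eq_sum
    (D := (latticeNeighbors p).image fun q => (some s(p, q), gridEndpoint n m q)), Finset.sum_image]
  · intro q _ q' _ hqq'
    exact Sym2.congr_right.1 (Option.some.inj (congrArg Prod.fst hqq'))
  · rintro ⟨e, w⟩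
    simp only [Finset.mem_image, Prod.mk.injEq, isLink_gridTR_site_iff hp]

lemma gridK_mulVec_apply (hp : p ∈ gridVertices n m) (u : ℤ × ℤ → ℝ) :
    (gridK n m).mulVec (fun q => u q) ⟨p, hp⟩ =
      ∑ q ∈ latticeNeighbors p, (u p - if q ∈ gridVertices n m then u q else 0) := by
  have eval (r : ℤ × ℤ) : ∑ q : gridVertices n m,
      indicator {GridVertex.site q} 1 (gridEndpoint n m r) * u q =
        if r ∈ gridVertices n m then u r else 0 := by
    classical
    rw [Finset.sum_coe_sort _
      fun q => indicator {GridVertex.site q} 1 (gridEndpoint n m r) * u q]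
    simp +contextual [indicator_apply, gridEndpoint_eq_site_iff, ite_and]
  simp only [Matrix.mulVec, dotProduct, gridK, Matrix.of_apply, graphLaplacian_gridTR_site hp,
    Finset.sum_mul]
  rw [Finset.sum_comm]
  simp only [sub_mul, Finset.sum_sub_distrib, eval, ← gridEndpoint_of_mem hp, if_pos hp]

lemma gridK_mulVec_branchCount (hp : p ∈ gridVertices n m) :
    (gridK n m).mulVec (fun q => branchCount (gridTR n m) none .terminal (.site q)) ⟨p, hp⟩ =
      if p = (1, 1) then ((tiSpanningTrees n m).ncard : ℝ) else 0 := by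
  set N : GridVertex → ℝ := fun v => branchCount (gridTR n m) none .terminal v with hN
  have hN_endpoint (q : ℤ × ℤ) : (if q ∈ gridVertices n m then N (.site q) else 0) =
      N (gridEndpoint n m q) - if q = (0, 1) then ((tiSpanningTrees n m).ncard : ℝ) else 0 := by
    by_cases hq : q ∈ gridVertices n m
    · have hne : q ≠ (0, 1) := fun h => zero_one_notMem_gridVertices (h ▸ hq)
      rw [if_pos hq, if_neg hne, gridEndpoint_of_mem hq, sub_zero]
    rw [if_neg hq]
    split_ifs with h
    · rw [h, gridEndpoint_zero_one, hN]
      simp only [branchCount_self, tiSpanningTrees_eq_spanningTreesThrough, sub_self]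
    · rw [gridEndpoint_of_notMem hq h, hN]
      simp only [branchCount_eq_zero isLink_gridTR_none, Nat.cast_zero, sub_zero]
  have hharmonic : graphLaplacian (gridTR n m) N (.site p) = 0 :=
    graphLaplacian_branchCount_eq_zero finite_edgeSet_gridTR isLink_gridTR_none
      (Or.inl ⟨p, hp, rfl⟩) (by simp) (by simp)
  have hcorner : (0, 1) ∈ latticeNeighbors p ↔ p = (1, 1) := by
    have := mem_gridVertices.1 hp
    simp only [latticeNeighbors, Finset.mem_insert, Finset.mem_singleton, Prod.ext_iff]
    omega
  rw [graphLaplacian_gridTR_site hp] at hharmonic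
  rw [gridK_mulVec_apply hp (fun q => N (.site q))]
  simp only [hN_endpoint, ← sub_add, Finset.sum_add_distrib, hharmonic, Finset.sum_ite_eq', hcorner,
    zero_add]

lemma expectedTILength_eq_sum_branchCount : expectedTILength n m =
    (∑ p ∈ gridVertices n m, (branchCount (gridTR n m) none .terminal (.site p) : ℝ)) /
      (tiSpanningTrees n m).ncard := by
  classical
  have hlength (F : Set (Option (Sym2 (ℤ × ℤ)))) : (tiLength n m F : ℝ) =
      ∑ p ∈ gridVertices n m,
        if JoinedBy (gridTR n m) (F \ {none}) .terminal (.site p) then 1 else 0 := by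
    simp only [tiLength, reaches_deleteEdges_restrict_iff, ← Finset.coe_filter, ncard_coe_finset,
      Finset.sum_boole]
  have hfin : (spanningTreesThrough (gridTR n m) none).Finite := finite_tiSpanningTrees
  rw [expectedTILength, tiSpanningTrees_eq_spanningTreesThrough,
    finsum_mem_eq_finite_toFinset_sum _ hfin]
  simp only [hlength, branchCount_eq_sum hfin]
  rw [Finset.sum_comm]

lemma expectedTILength_eq_sum_gridA (hn : 1 ≤ n) (hm : 1 ≤ m) (hK : IsUnit (gridK n m).det) :
    expectedTILength n m = ∑ p ∈ gridVertices n m, gridA n m p (1, 1) := by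
  classical
  have hcorner := one_one_mem_gridVertices hn hm
  have hcard : ((tiSpanningTrees n m).ncard : ℝ) ≠ 0 :=
    Nat.cast_ne_zero.2 ((ncard_pos finite_tiSpanningTrees).2 nonempty_tiSpanningTrees).ne'
  let N : gridVertices n m → ℝ := fun q => branchCount (gridTR n m) none .terminal (.site q)
  have hN : N = (gridK n m)⁻¹.mulVec
      (Pi.single ⟨(1, 1), hcorner⟩ ((tiSpanningTrees n m).ncard : ℝ)) := by
    have hKN : (gridK n m).mulVec N =
        Pi.single ⟨(1, 1), hcorner⟩ ((tiSpanningTrees n m).ncard : ℝ) := by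
      ext ⟨p, hp⟩
      simp only [N, gridK_mulVec_branchCount hp, Pi.single_apply, Subtype.mk.injEq]
    rw [← hKN, Matrix.mulVec_mulVec, Matrix.nonsing_inv_mul _ hK, Matrix.one_mulVec]
  rw [expectedTILength_eq_sum_branchCount, Finset.sum_div]
  refine Finset.sum_congr rfl fun p hp => ?_
  have hNp := congrFun hN ⟨p, hp⟩
  rw [Matrix.mulVec_single] at hNp
  rw [gridA, dif_pos ⟨hp, hcorner⟩, div_eq_iff hcard]
  simpa [N] using hNp

end Grid

/-! ### The Green function of the grid by separation of variables -/

/-- The frequency `π k / N` of the `k`-th sine on `{0, …, N}` vanishing at both ends. -/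
noncomputable def gridAngle (N k : ℕ) : ℝ := π * k / N

lemma gridAngle_mul_eq_nat_mul_pi {N : ℕ} (hN : N ≠ 0) (k : ℕ) : gridAngle N k * N = k * π := by
  rw [gridAngle, div_mul_cancel₀ _ (Nat.cast_ne_zero.2 hN), mul_comm]

lemma gridAngle_mem_Ioo {N k : ℕ} (hk : k ≠ 0) (hkN : k < N) : gridAngle N k ∈ Ioo 0 π := by
  have hk' : (0 : ℝ) < k := by positivity
  have hN : (0 : ℝ) < N := hk'.trans (by gcongr)
  refine ⟨by unfold gridAngle; positivity, ?_⟩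
  rw [gridAngle, mul_div_assoc]
  exact mul_lt_of_lt_one_right pi_pos ((div_lt_one hN).2 (by gcongr))

lemma cos_gridAngle_lt_one {N k : ℕ} (hk : k ≠ 0) (hkN : k < N) : cos (gridAngle N k) < 1 := by
  have hmem := gridAngle_mem_Ioo hk hkN
  simpa using cos_lt_cos_of_nonneg_of_le_pi le_rfl hmem.2.le hmem.1

lemma sum_cos_gridAngle_mul {N : ℕ} {j : ℤ} (hN : N ≠ 0) (hj : ¬ (2 * N : ℤ) ∣ j) :
    ∑ k ∈ Finset.range N, cos (gridAngle N k * j) = (1 - cos (j * π)) / 2 := by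
  set a : ℝ := π * j / N with ha
  have ha_ne (z : ℤ) : a ≠ z * (2 * π) := by
    intro h
    refine hj ⟨z, ?_⟩
    rw [ha, div_eq_iff (Nat.cast_ne_zero.2 hN)] at h
    have hz : (j : ℝ) = 2 * N * z := mul_left_cancel₀ pi_ne_zero (by linarith)
    exact_mod_cast hz
  have hNa : N * a = j * π := by
    rw [ha, mul_div_cancel₀ _ (Nat.cast_ne_zero.2 hN), mul_comm]
  have hsin : sin (a / 2) ≠ 0 := by
    rw [Ne, sin_eq_zero_iff]
    rintro ⟨z, hz⟩
    exact ha_ne z (by linarith)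
  have hterm (k : ℕ) : cos (gridAngle N k * j) = cos (a * k + 0) := by
    rw [gridAngle, ha]
    congr 1
    ring
  have hj_half : (j : ℝ) * π = 2 * (j * π / 2) := by ring
  have hdouble : sin (j * π / 2) * cos (j * π / 2) = 0 := by
    have := sin_int_mul_pi j
    rw [hj_half, sin_two_mul] at this
    linarith
  have hcos : cos (j * π) = 1 - 2 * sin (j * π / 2) ^ 2 := by
    rw [hj_half, cos_two_mul, cos_sq']
    ring_nf
  simp only [hterm]
  rw [sum_cos N ha_ne, sub_one_mul, sub_div, add_zero, hNa, cos_sub, div_eq_iff hsin, hcos]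
  linear_combination cos (a / 2) * hdouble

lemma sum_sin_mul_sin_gridAngle {N : ℕ} {x y : ℤ} (hx : x ∈ Ioo 0 (N : ℤ))
    (hy : y ∈ Ioo 0 (N : ℤ)) :
    ∑ k ∈ Finset.range N, sin (gridAngle N k * x) * sin (gridAngle N k * y) =
      if x = y then (N : ℝ) / 2 else 0 := by
  obtain ⟨hx0, hxN⟩ := hx
  obtain ⟨hy0, hyN⟩ := hy
  have hN : N ≠ 0 := by omega
  have hproduct (k : ℕ) : sin (gridAngle N k * x) * sin (gridAngle N k * y) =
      (cos (gridAngle N k * (x - y : ℤ)) - cos (gridAngle N k * (x + y : ℤ))) / 2 := by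
    push_cast
    rw [mul_sub, mul_add, cos_sub, cos_add]
    ring
  have hparity : cos ((x - y : ℤ) * π) = cos ((x + y : ℤ) * π) := by
    rw [← cos_sub_int_mul_two_pi ((x + y : ℤ) * π) y]
    congr 1
    push_cast
    ring
  have hadd : ¬ (2 * N : ℤ) ∣ x + y := fun h => by
    have := Int.le_of_dvd (by omega) h
    omega
  simp_rw [hproduct]
  rw [← Finset.sum_div, Finset.sum_sub_distrib, sum_cos_gridAngle_mul hN hadd, ← hparity]
  split_ifs with hxy
  · simp [hxy]
  · have hsub : ¬ (2 * N : ℤ) ∣ x - y := fun h =>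
      hxy (sub_eq_zero.1 (Int.eq_zero_of_abs_lt_dvd h (abs_lt.2 ⟨by omega, by omega⟩)))
    rw [sum_cos_gridAngle_mul hN hsub, sub_self, zero_div]

/-- The lattice function `sin (a x) sin (b y)`, an eigenfunction of the lattice Laplacian. -/
noncomputable def sineMode (a b : ℝ) (p : ℤ × ℤ) : ℝ := sin (a * p.1) * sin (b * p.2)

lemma sum_latticeNeighbors_sineMode (a b : ℝ) (p : ℤ × ℤ) :
    ∑ q ∈ latticeNeighbors p, (sineMode a b p - sineMode a b q) =
      2 * (2 - cos a - cos b) * sineMode a b p := by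
  rw [sum_latticeNeighbors]
  simp only [sineMode]
  push_cast
  simp only [mul_add, mul_sub, mul_one, sin_add, sin_sub]
  ring

/-- The Green function of the `n × m` grid, expanded in sines. The terms with `k = 0` or `l = 0`
vanish, also the one at `k = l = 0`, whose denominator is `0`. -/
noncomputable def gridGreen (n m : ℕ) (p q : ℤ × ℤ) : ℝ :=
  2 / ((n + 1 : ℕ) * (m + 1 : ℕ)) *
    ∑ k ∈ Finset.range (n + 1), ∑ l ∈ Finset.range (m + 1),
      sineMode (gridAngle (n + 1) k) (gridAngle (m + 1) l) p *
        sineMode (gridAngle (n + 1) k) (gridAngle (m + 1) l) q /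
        (2 - cos (gridAngle (n + 1) k) - cos (gridAngle (m + 1) l))

section GridGreen

variable {n m : ℕ} {p q : ℤ × ℤ}

lemma sin_gridAngle_mul_eq_zero {x : ℤ} (hx : x = 0 ∨ x = n + 1) (k : ℕ) :
    sin (gridAngle (n + 1) k * x) = 0 := by
  rcases hx with rfl | rfl
  · simp
  · have := gridAngle_mul_eq_nat_mul_pi n.succ_ne_zero k
    push_cast at this ⊢
    rw [this, sin_nat_mul_pi]

lemma gridGreen_eq_zero (h : (p.1 = 0 ∨ p.1 = n + 1) ∨ (p.2 = 0 ∨ p.2 = m + 1)) :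
    gridGreen n m p q = 0 := by
  refine mul_eq_zero_of_right _ (Finset.sum_eq_zero fun k _ => Finset.sum_eq_zero fun l _ => ?_)
  rcases h with h | h <;> simp [sineMode, sin_gridAngle_mul_eq_zero h]

lemma sum_latticeNeighbors_sineMode_div {k : ℕ} (hk : k < n + 1) (l : ℕ) (c : ℝ) :
    ∑ r ∈ latticeNeighbors p,
        (sineMode (gridAngle (n + 1) k) (gridAngle (m + 1) l) p * c /
            (2 - cos (gridAngle (n + 1) k) - cos (gridAngle (m + 1) l)) -
          sineMode (gridAngle (n + 1) k) (gridAngle (m + 1) l) r * c /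
            (2 - cos (gridAngle (n + 1) k) - cos (gridAngle (m + 1) l))) =
      2 * (sineMode (gridAngle (n + 1) k) (gridAngle (m + 1) l) p * c) := by
  simp only [← sub_div, ← sub_mul]
  rw [← Finset.sum_div, ← Finset.sum_mul, sum_latticeNeighbors_sineMode]
  have hk_le := cos_le_one (gridAngle (n + 1) k)
  have hl_le := cos_le_one (gridAngle (m + 1) l)
  rcases eq_or_ne k 0 with rfl | hk0
  · simp [sineMode, gridAngle]
  · have := cos_gridAngle_lt_one hk0 hk
    have hne : 2 - cos (gridAngle (n + 1) k) - cos (gridAngle (m + 1) l) ≠ 0 := by linarith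
    field_simp

lemma sum_latticeNeighbors_gridGreen (hp : p ∈ gridVertices n m) (hq : q ∈ gridVertices n m) :
    ∑ r ∈ latticeNeighbors p, (gridGreen n m p q - gridGreen n m r q) =
      if p = q then 1 else 0 := by
  have hp' := mem_gridVertices.1 hp
  have hq' := mem_gridVertices.1 hq
  have hseparate : ∑ r ∈ latticeNeighbors p, (gridGreen n m p q - gridGreen n m r q) =
      4 / ((n + 1 : ℕ) * (m + 1 : ℕ)) *
        ((∑ k ∈ Finset.range (n + 1), sin (gridAngle (n + 1) k * p.1) *
            sin (gridAngle (n + 1) k * q.1)) *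
          ∑ l ∈ Finset.range (m + 1), sin (gridAngle (m + 1) l * p.2) *
            sin (gridAngle (m + 1) l * q.2)) := by
    simp only [gridGreen, ← mul_sub, ← Finset.sum_sub_distrib, ← Finset.mul_sum]
    rw [Finset.sum_comm, Finset.sum_mul_sum]
    simp only [Finset.sum_comm (s := latticeNeighbors p), Finset.mul_sum]
    refine Finset.sum_congr rfl fun k hk => Finset.sum_congr rfl fun l _ => ?_
    rw [← Finset.mul_sum, sum_latticeNeighbors_sineMode_div (Finset.mem_range.1 hk)]
    simp only [sineMode]
    ring
  rw [hseparate, sum_sin_mul_sin_gridAngle (by simp; omega) (by simp; omega),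
    sum_sin_mul_sin_gridAngle (by simp; omega) (by simp; omega)]
  simp only [Prod.ext_iff, ite_and, mul_ite, ite_mul, mul_zero, zero_mul]
  split_ifs
  · field_simp
    norm_num
  all_goals rfl

lemma gridK_mul_gridGreen (n m : ℕ) :
    gridK n m * Matrix.of (fun p q : gridVertices n m => gridGreen n m p q) = 1 := by
  ext ⟨p, hp⟩ ⟨q, hq⟩
  have hboundary : ∀ r ∈ latticeNeighbors p,
      (if r ∈ gridVertices n m then gridGreen n m r q else 0) = gridGreen n m r q := by
    intro r hr
    split_ifs with hr'
    · rfl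
    · refine (gridGreen_eq_zero ?_).symm
      rw [mem_gridVertices] at hp hr'
      simp only [latticeNeighbors, Finset.mem_insert, Finset.mem_singleton, Prod.ext_iff] at hr
      omega
  calc (gridK n m * Matrix.of fun p q : gridVertices n m => gridGreen n m p q) ⟨p, hp⟩ ⟨q, hq⟩
    _ = (gridK n m).mulVec (fun r => gridGreen n m r q) ⟨p, hp⟩ := rfl
    _ = ∑ r ∈ latticeNeighbors p, (gridGreen n m p q - gridGreen n m r q) := by
      rw [gridK_mulVec_apply hp fun r => gridGreen n m r q]
      exact Finset.sum_congr rfl fun r hr => by rw [hboundary r hr]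
    _ = (1 : Matrix (gridVertices n m) (gridVertices n m) ℝ) ⟨p, hp⟩ ⟨q, hq⟩ := by
      simp only [sum_latticeNeighbors_gridGreen hp hq, Matrix.one_apply, Subtype.mk.injEq]

lemma isUnit_det_gridK (n m : ℕ) : IsUnit (gridK n m).det :=
  Matrix.isUnit_det_of_right_inverse (gridK_mul_gridGreen n m)

lemma gridA_eq_gridGreen (hp : p ∈ gridVertices n m) (hq : q ∈ gridVertices n m) :
    gridA n m p q = gridGreen n m p q := by
  rw [gridA, dif_pos ⟨hp, hq⟩, Matrix.inv_eq_right_inv (gridK_mul_gridGreen n m), Matrix.of_apply]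

lemma gridGreen_one_one (n m : ℕ) (x y : ℤ) : gridGreen n m (x, y) (1, 1) =
    2 / ((n + 1 : ℕ) * (m + 1 : ℕ)) *
      ∑ k ∈ Finset.range (n + 1), ∑ l ∈ Finset.range (m + 1),
        greenIntegrand x y (gridAngle (n + 1) k, gridAngle (m + 1) l) := by
  simp only [gridGreen, sineMode, greenIntegrand, Int.cast_one, mul_one, mul_assoc]

end GridGreen

/-! ### Riemann sums on rectangles -/

section RiemannSum

variable {E : Type*} [NormedAddCommGroup E] [NormedSpace ℝ E] [CompleteSpace E]

lemma norm_setIntegral_biUnion_sub_sum_le {α ι : Type*} [MeasurableSpace α] {μ : Measure α}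
    {s : Finset ι} {c : ι → Set α} {f : α → E} {v : ι → E} {ε : ℝ}
    (hmeas : ∀ i ∈ s, MeasurableSet (c i)) (hdisj : (s : Set ι).PairwiseDisjoint c)
    (hfin : ∀ i ∈ s, μ (c i) < ⊤) (hf : ∀ i ∈ s, IntegrableOn f (c i) μ)
    (hfv : ∀ i ∈ s, ∀ z ∈ c i, ‖f z - v i‖ ≤ ε) :
    ‖(∫ z in ⋃ i ∈ s, c i, f z ∂μ) - ∑ i ∈ s, μ.real (c i) • v i‖ ≤
      ε * μ.real (⋃ i ∈ s, c i) := by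
  rw [integral_biUnion_finset s hmeas hdisj hf, ← Finset.sum_sub_distrib,
    measureReal_biUnion_finset hdisj hmeas fun i hi => (hfin i hi).ne, Finset.mul_sum]
  refine norm_sum_le_of_le s fun i hi => ?_
  rw [← setIntegral_const, ← integral_sub (hf i hi) (integrableOn_const (hfin i hi).ne)]
  exact norm_setIntegral_le_of_norm_le_const (hfin i hi) (hfv i hi)

/-- The `k`-th of the `N` half-open intervals of equal length into which `(0, L]` is cut. -/
def meshInterval (L : ℝ) (N k : ℕ) : Set ℝ := Ioc (L * k / N) (L * (k + 1 : ℕ) / N)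

variable {L L' : ℝ} {N M : ℕ}

lemma monotone_mesh (hL : 0 ≤ L) (N : ℕ) : Monotone fun k : ℕ => L * k / N :=
  fun i j hij => by dsimp only; gcongr

lemma biUnion_meshInterval (hL : 0 ≤ L) (hN : N ≠ 0) :
    ⋃ k ∈ Finset.range N, meshInterval L N k = Ioc 0 L := by
  have hend : L * N / N = L := mul_div_cancel_right₀ L (Nat.cast_ne_zero.2 hN)
  simpa [hend, meshInterval] using (monotone_mesh hL N).biUnion_Ico_Ioc_map_succ 0 N

lemma pairwise_disjoint_meshInterval (hL : 0 ≤ L) (N : ℕ) :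
    Pairwise (Function.onFun Disjoint (meshInterval L N)) :=
  (monotone_mesh hL N).pairwise_disjoint_on_Ioc_succ

lemma biUnion_meshInterval_prod (hL : 0 ≤ L) (hL' : 0 ≤ L') (hN : N ≠ 0) (hM : M ≠ 0) :
    ⋃ i ∈ Finset.range N ×ˢ Finset.range M, meshInterval L N i.1 ×ˢ meshInterval L' M i.2 =
      Ioc 0 L ×ˢ Ioc 0 L' := by
  rw [← biUnion_meshInterval hL hN, ← biUnion_meshInterval hL' hM]
  ext z
  simp only [mem_iUnion, mem_prod, Finset.mem_product, Prod.exists]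
  grind

lemma pairwise_disjoint_meshInterval_prod (hL : 0 ≤ L) (hL' : 0 ≤ L') (N M : ℕ) :
    Pairwise (Function.onFun Disjoint fun i : ℕ × ℕ =>
      meshInterval L N i.1 ×ˢ meshInterval L' M i.2) := by
  intro i j hij
  rw [Function.onFun, Set.disjoint_prod]
  by_cases hfst : i.1 = j.1
  · exact Or.inr (pairwise_disjoint_meshInterval hL' M fun hsnd => hij (Prod.ext hfst hsnd))
  · exact Or.inl (pairwise_disjoint_meshInterval hL N hfst)

lemma volume_real_meshInterval (hL : 0 ≤ L) (N k : ℕ) :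
    volume.real (meshInterval L N k) = L / N := by
  rw [meshInterval, volume_real_Ioc_of_le (monotone_mesh hL N k.le_succ)]
  push_cast
  ring

lemma dist_le_of_mem_meshInterval {k : ℕ} {x : ℝ} (hx : x ∈ meshInterval L N k) :
    dist x (L * k / N) ≤ L / N := by
  obtain ⟨hlower, hupper⟩ := hx
  have hwidth : L * (k + 1 : ℕ) / N = L * k / N + L / N := by push_cast; ring
  rw [dist_eq, abs_of_pos (sub_pos.2 hlower)]
  linarith

lemma mul_natCast_div_mem_Icc {k : ℕ} (hL : 0 ≤ L) (hk : k ≤ N) : L * k / N ∈ Icc 0 L := by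
  refine ⟨by positivity, ?_⟩
  rw [mul_div_assoc]
  exact mul_le_of_le_one_right hL (div_le_one_of_le₀ (by gcongr) (by positivity))

lemma norm_setIntegral_prod_sub_riemannSum_le {f : ℝ × ℝ → E} {ε : ℝ} (hL : 0 ≤ L)
    (hL' : 0 ≤ L') (hN : N ≠ 0) (hM : M ≠ 0) (hf : IntegrableOn f (Ioc 0 L ×ˢ Ioc 0 L'))
    (hmod : ∀ k < N, ∀ l < M, ∀ z ∈ meshInterval L N k ×ˢ meshInterval L' M l,
      ‖f z - f (L * k / N, L' * l / M)‖ ≤ ε) :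
    ‖(∫ z in Ioc 0 L ×ˢ Ioc 0 L', f z) - (L / N * (L' / M)) •
      ∑ k ∈ Finset.range N, ∑ l ∈ Finset.range M, f (L * k / N, L' * l / M)‖ ≤ ε * (L * L') := by
  set cells := Finset.range N ×ˢ Finset.range M
  set cell : ℕ × ℕ → Set (ℝ × ℝ) := fun i => meshInterval L N i.1 ×ˢ meshInterval L' M i.2
  have hcover : ⋃ i ∈ cells, cell i = Ioc 0 L ×ˢ Ioc 0 L' :=
    biUnion_meshInterval_prod hL hL' hN hM
  have hcell (i : ℕ × ℕ) : volume.real (cell i) = L / N * (L' / M) := by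
    rw [Measure.volume_eq_prod, measureReal_prod_prod, volume_real_meshInterval hL,
      volume_real_meshInterval hL']
  have hrectangle : volume.real (Ioc 0 L ×ˢ Ioc 0 L' : Set (ℝ × ℝ)) = L * L' := by
    rw [Measure.volume_eq_prod, measureReal_prod_prod, volume_real_Ioc_of_le hL,
      volume_real_Ioc_of_le hL', sub_zero, sub_zero]
  have hfin : volume (Ioc 0 L ×ˢ Ioc 0 L' : Set (ℝ × ℝ)) < ⊤ := by
    rw [Measure.volume_eq_prod, Measure.prod_prod]
    exact ENNReal.mul_lt_top measure_Ioc_lt_top measure_Ioc_lt_top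
  have hsub : ∀ i ∈ cells, cell i ⊆ Ioc 0 L ×ˢ Ioc 0 L' :=
    fun i hi => hcover ▸ subset_biUnion_of_mem (u := cell) (Finset.mem_coe.2 hi)
  have hbound : ‖(∫ z in ⋃ i ∈ cells, cell i, f z) -
      ∑ i ∈ cells, volume.real (cell i) • f (L * i.1 / N, L' * i.2 / M)‖ ≤
        ε * volume.real (⋃ i ∈ cells, cell i) :=
    norm_setIntegral_biUnion_sub_sum_le (fun i _ => measurableSet_Ioc.prod measurableSet_Ioc)
      ((pairwise_disjoint_meshInterval_prod hL hL' N M).set_pairwise _)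
      (fun i hi => (measure_mono (hsub i hi)).trans_lt hfin)
      (fun i hi => hf.mono_set (hsub i hi))
      fun i hi => hmod i.1 (Finset.mem_range.1 (Finset.mem_product.1 hi).1) i.2
        (Finset.mem_range.1 (Finset.mem_product.1 hi).2)
  rwa [hcover, hrectangle, Finset.sum_congr rfl fun i _ => by rw [hcell i], ← Finset.smul_sum,
    Finset.sum_product] at hbound

lemma tendsto_riemannSum_prod {f : ℝ × ℝ → E} (hL : 0 ≤ L) (hL' : 0 ≤ L')
    (hf : ContinuousOn f (Icc 0 L ×ˢ Icc 0 L')) :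
    Tendsto (fun N : ℕ × ℕ => (L / N.1 * (L' / N.2)) •
        ∑ k ∈ Finset.range N.1, ∑ l ∈ Finset.range N.2, f (L * k / N.1, L' * l / N.2))
      atTop (𝓝 (∫ z in Ioc 0 L ×ˢ Ioc 0 L', f z)) := by
  have hcompact : IsCompact (Icc 0 L ×ˢ Icc 0 L') := isCompact_Icc.prod isCompact_Icc
  have hsubset : Ioc 0 L ×ˢ Ioc 0 L' ⊆ Icc 0 L ×ˢ Icc 0 L' :=
    prod_mono Ioc_subset_Icc_self Ioc_subset_Icc_self
  have huniform := Metric.uniformContinuousOn_iff.1 (hcompact.uniformContinuousOn_of_continuous hf)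
  rw [Metric.tendsto_nhds]
  intro ε hε
  obtain ⟨δ, hδ, hclose⟩ := huniform (ε / (L * L' + 1)) (by positivity)
  rw [← prod_atTop_atTop_eq]
  have hmesh (a : ℝ) : ∀ᶠ N : ℕ in atTop, a / N < δ ∧ N ≠ 0 :=
    ((tendsto_const_div_atTop_nhds_zero_nat a).eventually_lt_const hδ).and (eventually_ne_atTop 0)
  filter_upwards [(hmesh L).prod_mk (hmesh L')] with N ⟨⟨hstep, hN⟩, hstep', hN'⟩
  rw [dist_comm, dist_eq_norm]
  refine (norm_setIntegral_prod_sub_riemannSum_le hL hL' hN hN'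
    ((hf.integrableOn_compact hcompact).mono_set hsubset)
    (ε := ε / (L * L' + 1)) fun k hk l hl z hz => ?_).trans_lt ?_
  · have hz_mem : z ∈ Icc 0 L ×ˢ Icc 0 L' := by
      refine hsubset ⟨?_, ?_⟩
      · exact biUnion_meshInterval hL hN ▸ mem_biUnion (Finset.mem_range.2 hk) hz.1
      · exact biUnion_meshInterval hL' hN' ▸ mem_biUnion (Finset.mem_range.2 hl) hz.2
    rw [← dist_eq_norm]
    refine (hclose z hz_mem _ ⟨mul_natCast_div_mem_Icc hL hk.le,
      mul_natCast_div_mem_Icc hL' hl.le⟩ ?_).le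
    rw [Prod.dist_eq]
    exact max_lt ((dist_le_of_mem_meshInterval hz.1).trans_lt hstep)
      ((dist_le_of_mem_meshInterval hz.2).trans_lt hstep')
  · rw [div_mul_eq_mul_div, div_lt_iff₀ (by positivity)]
    linarith

end RiemannSum

/-! ### The limit of the Green function -/

lemma le_two_sub_cos_sub_cos {a b : ℝ} (ha : |a| ≤ π) (hb : |b| ≤ π) :
    2 / π ^ 2 * (a ^ 2 + b ^ 2) ≤ 2 - cos a - cos b := by
  have := cos_le_one_sub_mul_cos_sq ha
  have := cos_le_one_sub_mul_cos_sq hb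
  linarith

lemma abs_sin_mul_sin_div_le {a b : ℝ} (ha : |a| ≤ π) (hb : |b| ≤ π) :
    |sin a * sin b / (2 - cos a - cos b)| ≤ π ^ 2 / 4 := by
  have hdenom : 0 ≤ 2 - cos a - cos b := by linarith [cos_le_one a, cos_le_one b]
  rw [abs_div, abs_of_nonneg hdenom, abs_mul]
  refine div_le_of_le_mul₀ hdenom (by positivity) ?_
  calc |sin a| * |sin b| ≤ |a| * |b| := mul_le_mul abs_sin_le_abs abs_sin_le_abs (abs_nonneg _)
        (abs_nonneg _)
    _ ≤ (a ^ 2 + b ^ 2) / 2 := by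
        rw [← sq_abs a, ← sq_abs b]
        linarith [two_mul_le_add_sq |a| |b|]
    _ = π ^ 2 / 4 * (2 / π ^ 2 * (a ^ 2 + b ^ 2)) := by field_simp; norm_num
    _ ≤ _ := by gcongr; exact le_two_sub_cos_sub_cos ha hb

lemma abs_greenIntegrand_le (x y : ℤ) {z : ℝ × ℝ} (hz : |z.1| ≤ π ∧ |z.2| ≤ π) :
    |greenIntegrand x y z| ≤ π ^ 2 / 4 * |sin (z.1 * x)| := by
  rw [greenIntegrand, mul_assoc, mul_div_assoc, abs_mul, abs_mul, mul_comm (π ^ 2 / 4)]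
  exact mul_le_mul (mul_le_of_le_one_right (abs_nonneg _) (abs_sin_le_one _))
    (abs_sin_mul_sin_div_le hz.1 hz.2) (abs_nonneg _) (abs_nonneg _)

lemma continuousOn_greenIntegrand (x y : ℤ) :
    ContinuousOn (greenIntegrand x y) {z | |z.1| ≤ π ∧ |z.2| ≤ π} := by
  intro z hz
  by_cases hdenom : 2 - cos z.1 - cos z.2 = 0
  · have hz_fst : z.1 = 0 := by
      have hsq : 2 / π ^ 2 * (z.1 ^ 2 + z.2 ^ 2) ≤ 0 :=
        hdenom ▸ le_two_sub_cos_sub_cos hz.1 hz.2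
      have hsq_nonpos := nonpos_of_mul_nonpos_right hsq (by positivity)
      exact pow_eq_zero_iff two_ne_zero |>.1 (by nlinarith [sq_nonneg z.1, sq_nonneg z.2])
    have hmajorant : Tendsto (fun w : ℝ × ℝ => π ^ 2 / 4 * |sin (w.1 * x)|) (𝓝 z) (𝓝 0) := by
      have hcont : Continuous fun w : ℝ × ℝ => π ^ 2 / 4 * |sin (w.1 * x)| := by fun_prop
      simpa [hz_fst] using hcont.tendsto z
    have hvalue : greenIntegrand x y z = 0 := by simp [greenIntegrand, hdenom]
    rw [ContinuousWithinAt, hvalue]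
    refine squeeze_zero_norm' ?_ (hmajorant.mono_left nhdsWithin_le_nhds)
    filter_upwards [self_mem_nhdsWithin] with w hw using abs_greenIntegrand_le x y hw
  · unfold greenIntegrand
    exact ContinuousAt.continuousWithinAt (ContinuousAt.div (by fun_prop) (by fun_prop) hdenom)

lemma continuousOn_greenIntegrand_Icc (x y : ℤ) :
    ContinuousOn (greenIntegrand x y) (Icc 0 π ×ˢ Icc 0 π) :=
  (continuousOn_greenIntegrand x y).mono fun _ hz =>
    ⟨(abs_of_nonneg hz.1.1).trans_le hz.1.2, (abs_of_nonneg hz.2.1).trans_le hz.2.2⟩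

lemma integrableOn_greenIntegrand (x y : ℤ) :
    IntegrableOn (greenIntegrand x y) (Ioo 0 π ×ˢ Ioo 0 π) volume :=
  ((continuousOn_greenIntegrand_Icc x y).integrableOn_compact
    (isCompact_Icc.prod isCompact_Icc)).mono_set
    (prod_mono Ioo_subset_Icc_self Ioo_subset_Icc_self)

lemma tendsto_gridA {x y : ℤ} (hx : 1 ≤ x) (hy : 1 ≤ y) :
    Tendsto (fun N : ℕ × ℕ => gridA N.1 N.2 (x, y) (1, 1)) atTop
      (𝓝 (2 / π ^ 2 * ∫ z in Ioo 0 π ×ˢ Ioo 0 π, greenIntegrand x y z)) := by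
  have hopen : ∫ z in Ioo 0 π ×ˢ Ioo 0 π, greenIntegrand x y z =
      ∫ z in Ioc 0 π ×ˢ Ioc 0 π, greenIntegrand x y z :=
    setIntegral_congr_set (Measure.set_prod_ae_eq Ioo_ae_eq_Ioc Ioo_ae_eq_Ioc)
  have hsucc : Tendsto (fun N : ℕ × ℕ => (N.1 + 1, N.2 + 1)) atTop atTop := by
    rw [← prod_atTop_atTop_eq]
    exact (tendsto_add_atTop_nat 1).prodMap (tendsto_add_atTop_nat 1)
  rw [hopen]
  refine (((tendsto_riemannSum_prod pi_pos.le pi_pos.le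
    (continuousOn_greenIntegrand_Icc x y)).comp hsucc).const_mul (2 / π ^ 2)).congr' ?_
  filter_upwards [eventually_ge_atTop (x.toNat, y.toNat)] with N hN
  have hxN : x.toNat ≤ N.1 := hN.1
  have hyN : y.toNat ≤ N.2 := hN.2
  rw [gridA_eq_gridGreen (mem_gridVertices.2 ⟨by dsimp only; omega, by dsimp only; omega⟩)
    (one_one_mem_gridVertices (by omega) (by omega)), gridGreen_one_one]
  simp only [Function.comp, gridAngle, smul_eq_mul]
  rw [← mul_assoc]
  congr 1
  field_simp

/-! ### Sums of the Green function over the grid -/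

lemma sum_Icc_int_eq_sum_range {M : Type*} [AddCommMonoid M] (n : ℕ) {f : ℤ → M} (hf : f 0 = 0) :
    ∑ x ∈ Finset.Icc 1 (n : ℤ), f x = ∑ k ∈ Finset.range (n + 1), f k := by
  rw [Finset.sum_range_succ', Nat.cast_zero, hf, add_zero]
  refine Finset.sum_nbij' (fun x => (x - 1).toNat) (fun k => (k + 1 : ℕ)) ?_ ?_ ?_ ?_
    fun x hx => congrArg f ?_ <;> grind

lemma sum_range_ite_odd {M : Type*} [AddCommMonoid M] (N : ℕ) (f : ℕ → M) :
    ∑ k ∈ Finset.range N, (if Odd k then f k else 0) =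
      ∑ i ∈ Finset.range (N / 2), f (2 * i + 1) := by
  rw [← Finset.sum_filter]
  refine Finset.sum_nbij' (fun k => k / 2) (fun i => 2 * i + 1) ?_ ?_ ?_ ?_ ?_ <;>
    simp only [Finset.mem_filter, Finset.mem_range, Nat.odd_iff] <;> grind

lemma sum_sin_gridAngle_mul_sin (n k : ℕ) :
    (∑ x ∈ Finset.Icc 1 (n : ℤ), sin (gridAngle (n + 1) k * x)) * sin (gridAngle (n + 1) k) =
      if Odd k then 1 + cos (gridAngle (n + 1) k) else 0 := by
  set a := gridAngle (n + 1) k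
  have hperiod : a * (n + 1) = k * π :=
    mod_cast gridAngle_mul_eq_nat_mul_pi n.succ_ne_zero k
  have hdouble_sin : sin a = 2 * sin (a / 2) * cos (a / 2) := by rw [← sin_two_mul]; ring_nf
  have hdouble_cos : 1 + cos a = 2 * cos (a / 2) ^ 2 := by rw [cos_sq]; ring_nf
  have hclosed := sin_mul_sum_sin (n + 1) a 0
  have hfirst : ((n + 1 : ℕ) : ℝ) * a / 2 = k * π / 2 := by push_cast; linarith
  have hsecond : (((n + 1 : ℕ) : ℝ) - 1) * a / 2 + 0 = k * π / 2 - a / 2 := by push_cast; linarith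
  have hsin_sq : sin (k * π / 2) ^ 2 = (1 - (-1) ^ k) / 2 := by
    rw [sin_sq_eq_half_sub, mul_div_cancel₀ _ two_ne_zero, cos_nat_mul_pi]
    ring
  have hsin_cos : sin (k * π / 2) * cos (k * π / 2) = 0 := by
    have := sin_two_mul (k * π / 2)
    rw [mul_div_cancel₀ _ two_ne_zero, sin_nat_mul_pi] at this
    linarith
  rw [hfirst, hsecond, sin_sub] at hclosed
  rw [sum_Icc_int_eq_sum_range n (by simp)]
  simp only [Int.cast_natCast, add_zero] at hclosed ⊢
  have hsum : (∑ i ∈ Finset.range (n + 1), sin (a * i)) * sin a =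
      (1 - (-1) ^ k) / 2 * (1 + cos a) := by
    rw [hdouble_sin, hdouble_cos, ← hsin_sq]
    linear_combination 2 * cos (a / 2) * hclosed - 2 * cos (a / 2) * sin (a / 2) * hsin_cos
  rw [hsum]
  split_ifs with hodd
  · rw [hodd.neg_one_pow]
    ring
  · rw [(Nat.not_odd_iff_even.1 hodd).neg_one_pow]
    ring

lemma sum_gridVertices_greenIntegrand (n m : ℕ) (z : ℝ × ℝ) :
    ∑ p ∈ gridVertices n m, greenIntegrand p.1 p.2 z =
      ((∑ x ∈ Finset.Icc 1 (n : ℤ), sin (z.1 * x)) * sin z.1) *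
        ((∑ y ∈ Finset.Icc 1 (m : ℤ), sin (z.2 * y)) * sin z.2) / (2 - cos z.1 - cos z.2) := by
  simp only [greenIntegrand]
  rw [← Finset.sum_div, gridVertices, Finset.sum_product, mul_mul_mul_comm, Finset.sum_mul_sum]
  simp only [Finset.sum_mul, mul_assoc]

/-- The contribution of an odd frequency `(a, b)` to the sum of the Green function with pole
`(1, 1)` over the grid. -/
noncomputable def oddKernel (a b : ℝ) : ℝ := (1 + cos a) * (1 + cos b) / (2 - cos a - cos b)

lemma oddKernel_comm (a b : ℝ) : oddKernel a b = oddKernel b a := by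
  rw [oddKernel, oddKernel, mul_comm, sub_right_comm]

lemma sum_gridA {n m : ℕ} (hn : 1 ≤ n) (hm : 1 ≤ m) :
    ∑ p ∈ gridVertices n m, gridA n m p (1, 1) =
      2 / ((n + 1 : ℕ) * (m + 1 : ℕ)) *
        ∑ i ∈ Finset.range ((n + 1) / 2), ∑ j ∈ Finset.range ((m + 1) / 2),
          oddKernel (gridAngle (n + 1) (2 * i + 1)) (gridAngle (m + 1) (2 * j + 1)) := by
  have hfrequency (k l : ℕ) : ∑ p ∈ gridVertices n m,
      greenIntegrand p.1 p.2 (gridAngle (n + 1) k, gridAngle (m + 1) l) =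
      if Odd k then if Odd l then oddKernel (gridAngle (n + 1) k) (gridAngle (m + 1) l) else 0
      else 0 := by
    rw [sum_gridVertices_greenIntegrand, sum_sin_gridAngle_mul_sin, sum_sin_gridAngle_mul_sin]
    split_ifs <;> simp [oddKernel]
  calc ∑ p ∈ gridVertices n m, gridA n m p (1, 1)
    _ = ∑ p ∈ gridVertices n m, 2 / ((n + 1 : ℕ) * (m + 1 : ℕ)) *
          ∑ k ∈ Finset.range (n + 1), ∑ l ∈ Finset.range (m + 1),
            greenIntegrand p.1 p.2 (gridAngle (n + 1) k, gridAngle (m + 1) l) :=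
      Finset.sum_congr rfl fun p hp =>
        (gridA_eq_gridGreen hp (one_one_mem_gridVertices hn hm)).trans
          (gridGreen_one_one n m p.1 p.2)
    _ = 2 / ((n + 1 : ℕ) * (m + 1 : ℕ)) *
          ∑ k ∈ Finset.range (n + 1), ∑ l ∈ Finset.range (m + 1), ∑ p ∈ gridVertices n m,
            greenIntegrand p.1 p.2 (gridAngle (n + 1) k, gridAngle (m + 1) l) := by
      simp only [← Finset.mul_sum, Finset.sum_comm (s := gridVertices n m)]
    _ = _ := by
      simp only [hfrequency, Finset.sum_ite_irrel, Finset.sum_const_zero, sum_range_ite_odd]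

lemma sum_gridA_comm {n m : ℕ} (hn : 1 ≤ n) (hm : 1 ≤ m) :
    ∑ p ∈ gridVertices n m, gridA n m p (1, 1) = ∑ p ∈ gridVertices m n, gridA m n p (1, 1) := by
  rw [sum_gridA hn hm, sum_gridA hm hn, Finset.sum_comm, mul_comm ((n + 1 : ℕ) : ℝ)]
  simp only [oddKernel_comm]

lemma half_sq_sub_one_sub_cos_le (x : ℝ) : x ^ 2 / 2 - (1 - cos x) ≤ x ^ 4 / 2 := by
  rcases le_total |x| 1 with hx | hx
  · have hcos := (abs_le.1 (cos_bound hx)).2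
    rw [Even.pow_abs (by decide)] at hcos
    nlinarith [pow_nonneg (sq_nonneg x) 2]
  · nlinarith [cos_le_one x, (one_le_sq_iff_one_le_abs x).2 hx]

lemma abs_oddKernel_sub_le {a b : ℝ} (ha : |a| ≤ π) (hb : |b| ≤ π) (hab : 0 < a ^ 2 + b ^ 2) :
    |oddKernel a b - 8 / (a ^ 2 + b ^ 2)| ≤ 2 * π ^ 2 + 2 := by
  have hdenom := le_two_sub_cos_sub_cos ha hb
  set s := 2 - cos a - cos b with hs
  set r := a ^ 2 + b ^ 2 with hr
  have hs_pos : 0 < s := lt_of_lt_of_le (by positivity) hdenom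
  have hsplit : oddKernel a b - 8 / r =
      8 * (r / 2 - s) / (s * r) - 2 + (1 - cos a) * (1 - cos b) / s := by
    rw [oddKernel, ← hs]
    field_simp
    rw [hs]
    ring
  have hdefect_nonneg : 0 ≤ r / 2 - s := by
    linarith [one_sub_sq_div_two_le_cos (x := a), one_sub_sq_div_two_le_cos (x := b)]
  have hdefect_le : r / 2 - s ≤ r ^ 2 / 2 := by
    have := half_sq_sub_one_sub_cos_le a
    have := half_sq_sub_one_sub_cos_le b
    have : 0 ≤ a ^ 2 * b ^ 2 := by positivity
    rw [hs, hr]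
    nlinarith
  have hquotient_nonneg : 0 ≤ 8 * (r / 2 - s) / (s * r) := by positivity
  have hquotient_le : 8 * (r / 2 - s) / (s * r) ≤ 2 * π ^ 2 := by
    rw [div_le_iff₀ (by positivity)]
    calc 8 * (r / 2 - s) ≤ 2 * π ^ 2 * (2 / π ^ 2 * r * r) := by field_simp; linarith
      _ ≤ 2 * π ^ 2 * (s * r) := by gcongr
  have hcross_nonneg : 0 ≤ (1 - cos a) * (1 - cos b) / s :=
    div_nonneg (mul_nonneg (sub_nonneg.2 (cos_le_one a)) (sub_nonneg.2 (cos_le_one b))) hs_pos.le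
  have hcross_le : (1 - cos a) * (1 - cos b) / s ≤ 2 := by
    rw [div_le_iff₀ hs_pos, hs]
    nlinarith [cos_le_one a, cos_le_one b, neg_one_le_cos a, neg_one_le_cos b]
  rw [hsplit, abs_le]
  constructor <;> linarith [sq_nonneg π]

/-! ### Sums over odd numbers -/

/-- The error is at most the first term since the `i`-th term is sandwiched between the integrals
over `[2 i - 1, 2 i + 1]` and `[2 i + 1, 2 i + 3]`. -/
lemma sum_odd_sub_integral_mem_Icc {f : ℝ → ℝ} {M : ℕ}
    (hf : AntitoneOn f (Icc 1 (2 * M + 1))) (hM : 0 ≤ f (2 * M + 1)) :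
    ∑ i ∈ Finset.range M, f (2 * i + 1) - (∫ t in (1 : ℝ)..2 * M + 1, f t) / 2 ∈
      Icc 0 (f 1) := by
  have hanti : AntitoneOn (fun t : ℝ => f (2 * t + 1)) (Icc 0 (0 + M)) := fun s hs t ht hst =>
    hf ⟨by linarith [hs.1], by linarith [hs.2]⟩ ⟨by linarith [ht.1], by linarith [ht.2]⟩
      (by linarith)
  have hsubst : ∫ t in (0 : ℝ)..0 + M, f (2 * t + 1) = (∫ t in (1 : ℝ)..2 * M + 1, f t) / 2 := by
    rw [intervalIntegral.integral_comp_mul_add f two_ne_zero, smul_eq_mul, ← div_eq_inv_mul]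
    simp only [mul_zero, zero_add]
  have hlower := hanti.integral_le_sum
  have hupper := hanti.sum_le_integral
  have htelescope := Finset.sum_range_sub (fun i : ℕ => f (2 * i + 1)) M
  rw [Finset.sum_sub_distrib, Nat.cast_zero, mul_zero, zero_add] at htelescope
  simp only [zero_add] at hsubst hlower hupper
  exact ⟨by linarith, by linarith⟩

lemma antitoneOn_inv_sq_add_sq (c : ℝ) : AntitoneOn (fun t : ℝ => (c ^ 2 + t ^ 2)⁻¹) (Ioi 0) :=
  fun s hs t _ hst => by
    have hs_pos : 0 < s := hs
    dsimp only
    gcongr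

lemma arctan_le_self {x : ℝ} (hx : 0 ≤ x) : arctan x ≤ x :=
  (le_tan (arctan_nonneg.2 hx) (arctan_lt_pi_div_two x)).trans_eq (tan_arctan x)

lemma abs_sum_inv_sq_add_odd_sq_sub_le {c : ℝ} (hc : 0 < c) (M : ℕ) :
    |∑ j ∈ Finset.range M, (c ^ 2 + (2 * j + 1 : ℝ) ^ 2)⁻¹ - π / 4 * c⁻¹| ≤
      (c ^ 2)⁻¹ + (2 * M + 1 : ℝ)⁻¹ / 2 := by
  obtain ⟨hlower, hupper⟩ := sum_odd_sub_integral_mem_Icc (M := M)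
    ((antitoneOn_inv_sq_add_sq c).mono fun t ht => one_pos.trans_le ht.1) (by positivity)
  rw [integral_inv_sq_add_sq hc.ne', ← inv_div c, arctan_inv_of_pos (by positivity)]
    at hlower hupper
  have hstart : 0 ≤ arctan (1 / c) ∧ arctan (1 / c) ≤ c⁻¹ :=
    ⟨arctan_nonneg.2 (by positivity), (arctan_le_self (by positivity)).trans_eq (one_div c)⟩
  have hend : 0 ≤ arctan (c / (2 * M + 1)) ∧ arctan (c / (2 * M + 1)) ≤ c / (2 * M + 1) :=
    ⟨arctan_nonneg.2 (by positivity), arctan_le_self (by positivity)⟩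
  have hfirst : (c ^ 2 + 1 ^ 2)⁻¹ ≤ (c ^ 2)⁻¹ := by
    gcongr
    exact le_add_of_nonneg_right (by positivity)
  set T := ∑ j ∈ Finset.range M, (c ^ 2 + (2 * j + 1 : ℝ) ^ 2)⁻¹
  have hdefect : c⁻¹ * (arctan (1 / c) + arctan (c / (2 * M + 1))) ≤
      (c ^ 2)⁻¹ + (2 * M + 1 : ℝ)⁻¹ := by
    calc c⁻¹ * (arctan (1 / c) + arctan (c / (2 * M + 1))) ≤ c⁻¹ * (c⁻¹ + c / (2 * M + 1)) := by
          gcongr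
          exacts [hstart.2, hend.2]
      _ = (c ^ 2)⁻¹ + (2 * M + 1 : ℝ)⁻¹ := by field_simp
  have hdefect_nonneg : 0 ≤ c⁻¹ * (arctan (1 / c) + arctan (c / (2 * M + 1))) :=
    mul_nonneg (by positivity) (add_nonneg hstart.1 hend.1)
  have : (0 : ℝ) < (2 * M + 1 : ℝ)⁻¹ := by positivity
  have : 0 < (c ^ 2)⁻¹ := by positivity
  rw [abs_le]
  constructor <;> linarith

lemma sum_inv_odd_sq_le (M : ℕ) :
    ∑ i ∈ Finset.range M, ((2 * i + 1 : ℝ) ^ 2)⁻¹ ≤ 3 / 2 := by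
  have hanti : AntitoneOn (fun t : ℝ => (t ^ 2)⁻¹) (Icc 1 (2 * M + 1)) := by
    simpa using (antitoneOn_inv_sq_add_sq 0).mono fun t ht => one_pos.trans_le ht.1
  have hintegral : ∫ t in (1 : ℝ)..2 * M + 1, (t ^ 2)⁻¹ = 1 - (2 * M + 1 : ℝ)⁻¹ := by
    have hzpow (t : ℝ) : (t ^ 2)⁻¹ = t ^ (-2 : ℤ) := by rw [zpow_neg, zpow_ofNat]
    simp only [hzpow]
    rw [integral_zpow (Or.inr ⟨by decide, notMem_uIcc_of_lt one_pos (by positivity)⟩)]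
    norm_num
    ring
  have hM : (0 : ℝ) < (2 * M + 1 : ℝ)⁻¹ := by positivity
  have hupper := (sum_odd_sub_integral_mem_Icc hanti (by positivity)).2
  rw [hintegral, one_pow, inv_one] at hupper
  linarith

lemma abs_sum_inv_odd_sub_le (M : ℕ) :
    |∑ i ∈ Finset.range M, (2 * i + 1 : ℝ)⁻¹ - log (2 * M + 1) / 2| ≤ 1 := by
  have hanti : AntitoneOn (fun t : ℝ => t⁻¹) (Icc 1 (2 * M + 1)) := fun s hs t _ hst =>
    inv_anti₀ (one_pos.trans_le hs.1) hst
  obtain ⟨hlower, hupper⟩ := sum_odd_sub_integral_mem_Icc hanti (by positivity)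
  rw [integral_inv_of_pos one_pos (by positivity), div_one] at hlower hupper
  rw [inv_one] at hupper
  rwa [abs_of_nonneg hlower]

/-- The sum of `1 / (x² + y²)` over the points `(x, y)` with `x` an odd multiple of `ρ` and `y` an
odd number, `I × J` of them. For an elongated grid `ρ` is the aspect ratio. -/
noncomputable def oddLatticeSum (ρ : ℝ) (I J : ℕ) : ℝ :=
  ∑ i ∈ Finset.range I, ∑ j ∈ Finset.range J, ((ρ * (2 * i + 1)) ^ 2 + (2 * j + 1 : ℝ) ^ 2)⁻¹

lemma abs_mul_oddLatticeSum_sub_le {ρ : ℝ} {I J : ℕ} (hρ : 1 ≤ ρ) (hIJ : 2 * (ρ * I) ≤ 2 * J + 1) :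
    |ρ * oddLatticeSum ρ I J - π / 4 * ∑ i ∈ Finset.range I, (2 * i + 1 : ℝ)⁻¹| ≤ 7 / 4 := by
  have hρ_pos : 0 < ρ := one_pos.trans_le hρ
  have hrow (i : ℕ) : |ρ * ∑ j ∈ Finset.range J, ((ρ * (2 * i + 1)) ^ 2 + (2 * j + 1 : ℝ) ^ 2)⁻¹ -
      π / 4 * (2 * i + 1 : ℝ)⁻¹| ≤ ((2 * i + 1 : ℝ) ^ 2)⁻¹ + ρ * ((2 * J + 1 : ℝ)⁻¹ / 2) := by
    have hinner := abs_sum_inv_sq_add_odd_sq_sub_le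
      (mul_pos hρ_pos (by positivity : (0 : ℝ) < 2 * i + 1)) J
    have hscale : ρ * (π / 4 * (ρ * (2 * i + 1))⁻¹) = π / 4 * (2 * i + 1 : ℝ)⁻¹ := by field_simp
    rw [← hscale, ← mul_sub, abs_mul, abs_of_pos hρ_pos]
    refine (mul_le_mul_of_nonneg_left hinner hρ_pos.le).trans ?_
    rw [mul_add]
    gcongr
    rw [mul_pow, mul_inv, ← mul_assoc]
    refine mul_le_of_le_one_left (by positivity) ?_
    rw [← div_eq_mul_inv, div_le_one (by positivity)]
    exact le_self_pow₀ hρ two_ne_zero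
  have htail : (I : ℝ) * (ρ * ((2 * J + 1 : ℝ)⁻¹ / 2)) ≤ 1 / 4 := by
    calc (I : ℝ) * (ρ * ((2 * J + 1 : ℝ)⁻¹ / 2)) = 2 * (ρ * I) / (2 * J + 1) / 4 := by
          field_simp
          norm_num
      _ ≤ 1 / 4 := by
          gcongr
          exact (div_le_one (by positivity)).2 hIJ
  calc |ρ * oddLatticeSum ρ I J - π / 4 * ∑ i ∈ Finset.range I, (2 * i + 1 : ℝ)⁻¹|
    _ ≤ ∑ i ∈ Finset.range I, (((2 * i + 1 : ℝ) ^ 2)⁻¹ + ρ * ((2 * J + 1 : ℝ)⁻¹ / 2)) := by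
      rw [oddLatticeSum, Finset.mul_sum, Finset.mul_sum, ← Finset.sum_sub_distrib]
      exact (Finset.abs_sum_le_sum_abs _ _).trans (Finset.sum_le_sum fun i _ => hrow i)
    _ ≤ 7 / 4 := by
      rw [Finset.sum_add_distrib, Finset.sum_const, Finset.card_range, nsmul_eq_mul]
      linarith [sum_inv_odd_sq_le I]

/-! ### Asymptotics of the expected length -/

lemma mul_oddLatticeSum_eq_sum_gridAngle (n m I J : ℕ) :
    16 / π ^ 2 * (((m + 1 : ℕ) / (n + 1 : ℕ) : ℝ) *
        oddLatticeSum ((m + 1 : ℕ) / (n + 1 : ℕ)) I J) =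
      2 / ((n + 1 : ℕ) * (m + 1 : ℕ)) * ∑ i ∈ Finset.range I, ∑ j ∈ Finset.range J,
        8 / (gridAngle (n + 1) (2 * i + 1) ^ 2 + gridAngle (m + 1) (2 * j + 1) ^ 2) := by
  simp only [oddLatticeSum, gridAngle, Finset.mul_sum]
  refine Finset.sum_congr rfl fun i _ => Finset.sum_congr rfl fun j _ => ?_
  push_cast
  field_simp
  norm_num

lemma abs_sum_gridA_sub_oddLatticeSum_le {n m : ℕ} (hn : 1 ≤ n) (hm : 1 ≤ m) :
    |∑ p ∈ gridVertices n m, gridA n m p (1, 1) -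
      16 / π ^ 2 * (((m + 1 : ℕ) / (n + 1 : ℕ) : ℝ) *
        oddLatticeSum ((m + 1 : ℕ) / (n + 1 : ℕ)) ((n + 1) / 2) ((m + 1) / 2))| ≤
      2 * (2 * π ^ 2 + 2) := by
  have hangle {N i : ℕ} (hi : i ∈ Finset.range ((N + 1) / 2)) :
      0 < gridAngle (N + 1) (2 * i + 1) ∧ |gridAngle (N + 1) (2 * i + 1)| ≤ π := by
    have hmem : gridAngle (N + 1) (2 * i + 1) ∈ Ioo 0 π :=
      gridAngle_mem_Ioo (by omega) (by rw [Finset.mem_range] at hi; omega)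
    exact ⟨hmem.1, (abs_of_pos hmem.1).trans_le hmem.2.le⟩
  rw [sum_gridA hn hm, mul_oddLatticeSum_eq_sum_gridAngle, ← mul_sub, ← Finset.sum_sub_distrib,
    abs_mul, abs_of_pos (by positivity)]
  simp only [← Finset.sum_sub_distrib]
  have hterms : |∑ i ∈ Finset.range ((n + 1) / 2), ∑ j ∈ Finset.range ((m + 1) / 2),
      (oddKernel (gridAngle (n + 1) (2 * i + 1)) (gridAngle (m + 1) (2 * j + 1)) -
        8 / (gridAngle (n + 1) (2 * i + 1) ^ 2 + gridAngle (m + 1) (2 * j + 1) ^ 2))| ≤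
      ((n + 1) / 2 : ℕ) * (((m + 1) / 2 : ℕ) * (2 * π ^ 2 + 2)) := by
    refine ((Finset.abs_sum_le_sum_abs _ _).trans (Finset.sum_le_sum fun i hi =>
      (Finset.abs_sum_le_sum_abs _ _).trans (Finset.sum_le_sum fun j hj =>
        abs_oddKernel_sub_le (hangle hi).2 (hangle hj).2 ?_))).trans_eq ?_
    · have := (hangle hi).1
      positivity
    · simp only [Finset.sum_const, Finset.card_range, nsmul_eq_mul]
  refine (mul_le_mul_of_nonneg_left hterms (by positivity)).trans ?_
  calc (2 / ((n + 1 : ℕ) * (m + 1 : ℕ)) : ℝ) *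
        (((n + 1) / 2 : ℕ) * (((m + 1) / 2 : ℕ) * (2 * π ^ 2 + 2)))
    _ ≤ 2 / ((n + 1 : ℕ) * (m + 1 : ℕ)) * ((n + 1 : ℕ) * ((m + 1 : ℕ) * (2 * π ^ 2 + 2))) := by
      gcongr <;> exact Nat.div_le_self _ _
    _ = 2 * (2 * π ^ 2 + 2) := by field_simp

lemma abs_log_odd_sub_log_le {n : ℕ} (hn : 1 ≤ n) :
    |log (2 * ((n + 1) / 2 : ℕ) + 1) - log n| ≤ 2 := by
  have hn_cast : (1 : ℝ) ≤ n := by exact_mod_cast hn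
  have hlower : (n : ℝ) ≤ 2 * ((n + 1) / 2 : ℕ) + 1 := by
    exact_mod_cast (by omega : n ≤ 2 * ((n + 1) / 2) + 1)
  have hupper : (2 * ((n + 1) / 2 : ℕ) + 1 : ℝ) ≤ 3 * n := by
    exact_mod_cast (by omega : 2 * ((n + 1) / 2) + 1 ≤ 3 * n)
  have hlog := log_le_sub_one_of_pos
    (div_pos (by positivity : (0 : ℝ) < 2 * ((n + 1) / 2 : ℕ) + 1) (by linarith : (0 : ℝ) < n))
  rw [log_div (by positivity) (by positivity)] at hlog
  rw [abs_of_nonneg (sub_nonneg.2 (log_le_log (by linarith) hlower))]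
  have hratio := div_le_of_le_mul₀ (by positivity) (by positivity) hupper
  linarith

lemma exists_abs_sum_gridA_sub_log_min_le :
    ∃ C, ∀ n m : ℕ, 1 ≤ n → 1 ≤ m →
      |∑ p ∈ gridVertices n m, gridA n m p (1, 1) - 2 / π * log (min n m : ℕ)| ≤ C := by
  refine ⟨2 * (2 * π ^ 2 + 2) + 16 / π ^ 2 * (7 / 4) + 4 / π * 2, fun n m hn hm => ?_⟩
  wlog hnm : n ≤ m generalizing n m
  · rw [sum_gridA_comm hn hm, min_comm]
    exact this m n hm hn (le_of_not_ge hnm)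
  rw [min_eq_left hnm]
  have hkernel := abs_sum_gridA_sub_oddLatticeSum_le hn hm
  have hρ : (1 : ℝ) ≤ (m + 1 : ℕ) / (n + 1 : ℕ) := by
    rw [one_le_div (by positivity)]
    gcongr
  have hrange : 2 * (((m + 1 : ℕ) / (n + 1 : ℕ) : ℝ) * ((n + 1) / 2 : ℕ)) ≤
      2 * ((m + 1) / 2 : ℕ) + 1 := by
    have hhalf : (2 * ((n + 1) / 2 : ℕ) : ℝ) ≤ (n + 1 : ℕ) :=
      mod_cast (by omega : 2 * ((n + 1) / 2) ≤ n + 1)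
    calc 2 * (((m + 1 : ℕ) / (n + 1 : ℕ) : ℝ) * ((n + 1) / 2 : ℕ))
      _ = (m + 1 : ℕ) / (n + 1 : ℕ) * (2 * ((n + 1) / 2 : ℕ)) := by ring
      _ ≤ (m + 1 : ℕ) / (n + 1 : ℕ) * (n + 1 : ℕ) := by gcongr
      _ = (m + 1 : ℕ) := by field_simp
      _ ≤ 2 * ((m + 1) / 2 : ℕ) + 1 := mod_cast (by omega : m + 1 ≤ 2 * ((m + 1) / 2) + 1)
  have hrows := abs_mul_oddLatticeSum_sub_le hρ hrange
  have hharmonic := abs_sum_inv_odd_sub_le ((n + 1) / 2)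
  have hlog := abs_log_odd_sub_log_le hn
  set S := ∑ p ∈ gridVertices n m, gridA n m p (1, 1)
  set D := ((m + 1 : ℕ) / (n + 1 : ℕ) : ℝ) * oddLatticeSum _ _ _
  set H := ∑ i ∈ Finset.range ((n + 1) / 2), (2 * i + 1 : ℝ)⁻¹
  have hH : |H - log n / 2| ≤ 2 := by
    rw [abs_le] at hharmonic hlog ⊢
    constructor <;> linarith
  calc |S - 2 / π * log n|
    _ = |(S - 16 / π ^ 2 * D) + 16 / π ^ 2 * (D - π / 4 * H) + 4 / π * (H - log n / 2)| := by
      congr 1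
      field_simp
      ring
    _ ≤ |S - 16 / π ^ 2 * D| + |16 / π ^ 2 * (D - π / 4 * H)| + |4 / π * (H - log n / 2)| :=
      abs_add_three _ _ _
    _ ≤ _ := by
      rw [abs_mul, abs_mul, abs_of_pos (by positivity : 0 < 16 / π ^ 2),
        abs_of_pos (by positivity : 0 < 4 / π)]
      gcongr

lemma isEquivalent_of_eventually_abs_sub_le {α : Type*} {l : Filter α} {f g : α → ℝ} {C : ℝ}
    (hfg : ∀ᶠ x in l, |f x - g x| ≤ C) (hg : Tendsto g l atTop) :
    Asymptotics.IsEquivalent l f g := by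
  refine Asymptotics.IsBigO.trans_isLittleO (g := fun _ => (1 : ℝ)) (.of_bound C ?_)
    ((Asymptotics.isLittleO_one_left_iff ℝ).2 (tendsto_norm_atTop_atTop.comp hg))
  simpa using hfg

lemma isEquivalent_sum_gridA :
    Asymptotics.IsEquivalent atTop
      (fun N : ℕ × ℕ => ∑ p ∈ gridVertices N.1 N.2, gridA N.1 N.2 p (1, 1))
      (fun N => 2 / π * log (min N.1 N.2 : ℕ)) := by
  obtain ⟨C, hC⟩ := exists_abs_sum_gridA_sub_log_min_le
  have hmin : Tendsto (fun N : ℕ × ℕ => min N.1 N.2) atTop atTop :=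
    tendsto_atTop.2 fun b => (eventually_ge_atTop (b, b)).mono fun _ hN => le_min hN.1 hN.2
  refine isEquivalent_of_eventually_abs_sub_le (C := C) ?_ <|
    (tendsto_log_atTop.comp (tendsto_natCast_atTop_atTop.comp hmin)).const_mul_atTop
      (by positivity)
  filter_upwards [eventually_ge_atTop (1, 1)] with N hN using hC N.1 N.2 hN.1 hN.2

theorem mainTheorem4_general :
    (∀ n m : ℕ, IsUnit (gridK n m).det) ∧
    (∀ x y : ℤ, 1 ≤ x → 1 ≤ y →
      IntegrableOn (greenIntegrand x y) (Ioo 0 π ×ˢ Ioo 0 π) volume ∧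
      Tendsto (fun N : ℕ × ℕ => gridA N.1 N.2 (x, y) (1, 1)) atTop
        (𝓝 (2 / π ^ 2 * ∫ z in Ioo 0 π ×ˢ Ioo 0 π, greenIntegrand x y z))) ∧
    (∀ n m : ℕ, 1 ≤ n → 1 ≤ m →
      expectedTILength n m = ∑ p ∈ gridVertices n m, gridA n m p (1, 1)) ∧
    Asymptotics.IsEquivalent atTop (fun N : ℕ × ℕ => expectedTILength N.1 N.2)
      (fun N => 2 / π * log (min N.1 N.2 : ℕ)) := by
  have hlength (n m : ℕ) (hn : 1 ≤ n) (hm : 1 ≤ m) :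
      expectedTILength n m = ∑ p ∈ gridVertices n m, gridA n m p (1, 1) :=
    expectedTILength_eq_sum_gridA hn hm (isUnit_det_gridK n m)
  refine ⟨isUnit_det_gridK, fun x y hx hy => ⟨integrableOn_greenIntegrand x y,
    tendsto_gridA hx hy⟩, hlength, isEquivalent_sum_gridA.congr_left ?_⟩
  filter_upwards [eventually_ge_atTop (1, 1)] with N hN using (hlength N.1 N.2 hN.1 hN.2).symm

theorem mainTheorem4 :
    (∀ n : ℕ, 1 ≤ n → IsUnit (gridK n n).det) ∧
    (∀ x y : ℤ, 1 ≤ x → 1 ≤ y →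
      IntegrableOn (greenIntegrand x y) (Ioo 0 π ×ˢ Ioo 0 π) volume ∧
      Tendsto (fun n : ℕ => gridA n n (x, y) (1, 1)) atTop
        (𝓝 (2 / π ^ 2 * ∫ z in Ioo 0 π ×ˢ Ioo 0 π, greenIntegrand x y z))) ∧
    (∀ n : ℕ, 1 ≤ n →
      expectedTILength n n = ∑ p ∈ gridVertices n n, gridA n n p (1, 1)) ∧
    Asymptotics.IsEquivalent atTop (fun n : ℕ => expectedTILength n n)
      (fun n : ℕ => 2 / π * Real.log n) := by
  obtain ⟨hunit, hlimit, hlength, hasymptotics⟩ := mainTheorem4_general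
  refine ⟨fun n _ => hunit n n, fun x y hx hy => (hlimit x y hx hy).imp_right fun htendsto => ?_,
    fun n hn => hlength n n hn hn, ?_⟩
  · simpa only [Function.comp_def] using htendsto.comp (tendsto_atTop_diagonal (α := ℕ))
  · simpa only [Function.comp_def, min_self] using
      hasymptotics.comp_tendsto (tendsto_atTop_diagonal (α := ℕ))
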